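/- Setting. Consider $x_{t+1}=Ax_t+Bu_t$ on $\mathbb R^{d_x}\times\mathbb R^{d_u}$ (Euclidean norms, operator norm for $B$), with constraints $x_t\in\mathcal X$, $u_t\in\mathcal U$, where $\mathcal X,\mathcal U$ are closed, contain $0$, and $\mathcal U$ is bounded; put $B_u=\sup_{u\in\mathcal U}\|u\|$. Let $Q\succeq0$, $R\succ0$, let $P\succ 0$ solve the Riccati equation $P=A^\top PA-A^\top PB(R+B^\top PB)^{-1}B^\top PA+Q$, let $K=-(R+B^\top PB)^{-1}B^\top PA$ and $\pi^{\mathrm{lqr}}(x)=Kx$. Let $\varepsilon\in(0,1)$, $\mathcal W=\{w:\|w\|\le\varepsilon\}$, and let $\mathcal E$ be a neighbourhood of $0$ with $(A+BK)\mathcal E+\mathcal W\subseteq\mathcal E$. With $\mathcal S\ominus\mathcal Y=\{x\in \mathcal S: x+\mathcal Y\subseteq\mathcal S\}$ put $\bar{\mathcal X}=\mathcal X\ominus\mathcal E$, $\bar{\mathcal U}=\mathcal U\ominus K\mathcal E$. Let $\bar{\mathcal O}_\infty$ be the largest set $\mathcal O\subseteq\bar{\mathcal X}$ such that $(A+BK)^tx\in\mathcal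 O$ and $K(A+BK)^tx\in\bar{\mathcal U}$ for all $x\in\mathcal O$, $t\ge0$. Fix $N\ge1$. Call $(x_0,u_0,\dots,u_{N-1})$ feasible if $x_k\in\bar{\mathcal X}$, $u_k\in\bar{\mathcal U}$ for $k<N$ and $x_N\in\bar{\mathcal O}_\infty$, where $x_{k+1}=Ax_k+Bu_k$; let $\bar{\mathcal X}_0$ be the set of $x_0$ admitting such $u$. For $x\in(\bar{\mathcal X}_0+\mathcal E)\cap\mathcal X$ let $(\bar x_0,\bar u_0,\dots,\bar u_{N-1})$ be a minimizer of $\sum_{k<N}(x_k^\top Qx_k+u_k^\top Ru_k)+x_N^\top Px_N$ over all feasible $(x_0,u)$ with $x-x_0\in\mathcal E$; the robust MPC controller is $\pi_\star(x)=\bar u_0+K(x-\bar x_0)$. Outside this domain $\pi_\star$ is extended arbitrarily. Let $\mathcal D$ be a probability distribution with bounded support, almost surely in $\bar{\mathcal X}_0$. Let $\Pi\ni\pi_\star$ be a finite set of measurable controllers with $\pi(x)\in\mathcal U$ for all $\pi\in\Pi$, $x\in\mathcal X$. Let $\tau^\star_\infty\in\{1,2,\dots\}\cup\{\infty\}$ be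 the least $\tau\ge1$ such that for $\mathcal D$-almost every $x_0$ and all disturbances $w_t\in\mathcal W$ the trajectory $x_{t+1}=Ax_t+B\pi_\star(x_t)+w_t$ satisfies $x_\tau\in\bar{\mathcal O}_\infty$ ($\infty$ if there is none). Forward-Switch. Let $T\ge1$, $c=\sum_{t\ge1}1/(t\ln^2(t+1))$ and $n_t=\lceil c\,n\,t\lceil\ln^2(t+1)\rceil+n\rceil$. At stage $t=0,1,\dots,T-1$ draw $n_t$ fresh i.i.d. initial states from $\mathcal D$, run the policies $\hat\pi_0,\dots,\hat\pi_{t-1}$ learned so far to obtain states $\hat x_t^{(i)}$, and let $\hat\pi_t$ minimize $\frac1{n_t}\sum_i\|\pi_\star(\hat x_t^{(i)})-\pi(\hat x_t^{(i)})\|$ over $\pi\in\Pi$. Then draw $\ell$ further fresh i.i.d. initial states from $\mathcal D$ and run $\hat\pi_0,\dots,\hat\pi_t$; if all $\ell$ states at time $t+1$ lie in $\bar{\mathcal O}_\infty$, stop with $\hat\tau_\infty=t+1$. If this never happens, $\hat\tau_\infty=T$. The output $\tilde\pi$ uses $\hat\pi_t$ for $t<\hat\tau_\infty$ and $\pi^{\mathrm{lqr}}$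 for $t\ge\hat\tau_\infty$. Write $\hat x_t$ for the state at time $t$ under $\hat\pi$ from an initial state $x_0$. Theorem. Let $\delta\in(0,1)$, $\ell\ge\frac{10\ln(T/\delta)}{\delta}$ and $n\ge\frac{14\,\ell\,\|B\|\,B_u\ln(2T\ell|\Pi|/\delta)}{\varepsilon\delta}$. (0) If $Q\succ0$ and $0$ is an interior point of $\bar{\mathcal O}_\infty\ominus\mathcal E$, then $\tau_\infty^\star<\infty$. Moreover there is an event of probability at least $1-3\delta$ over the training on which all of the following hold, probabilities being over $x_0\sim\mathcal D$ with the trained $\hat\pi,\hat\tau_\infty$ fixed. (i) $\hat\tau_\infty\le\tau_\infty^\star$. (ii) If $\tau_\infty^\star\le T$ or $\hat\tau_\infty<T$, then $\Pr[\hat x_{\hat\tau_\infty}\in\bar{\mathcal O}_\infty]\ge1-\delta$. (iii) $\Pr[\forall t<\hat\tau_\infty:\ \|B\|\,\|\pi_\star(\hat x_t)-\hat\pi_t(\hat x_t)\|\le\varepsilon]\ge1-\delta$. (iv) For every $x_0\in\bar{\mathcal X}_0$ in the two events of (ii) and (iii), the trajectory of $\tilde\pi$ from $x_0$ satisfies $x_t\in\mathcal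 X$ and $\tilde\pi_t(x_t)\in\mathcal U$ for all $t\ge0$. -/

import Mathlib

open MeasureTheory ProbabilityTheory
open scoped Matrix Matrix.Norms.L2Operator

noncomputable section

/-- `ℝᵈ` with the Euclidean norm. -/
abbrev Vec (d : ℕ) := EuclideanSpace ℝ (Fin d)

/-- A (time-invariant) controller: a map from states to inputs. -/
abbrev Policy (dx du : ℕ) := Vec dx → Vec du

/-- The quadratic form `xᵀ M x`. -/
def quad {d : ℕ} (M : Matrix (Fin d) (Fin d) ℝ) (x : Vec d) : ℝ :=
  x.ofLp ⬝ᵥ (M *ᵥ x.ofLp)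

/-- The set difference `S ⊖ Y = {x ∈ S | x + Y ⊆ S}`. -/
def erode {d : ℕ} (S Y : Set (Vec d)) : Set (Vec d) :=
  {x | x ∈ S ∧ ∀ y ∈ Y, x + y ∈ S}

/-- The data of a robust MPC problem: system matrices `A, B`, cost matrices `Q, R`, Riccati
matrix `P`, horizon `N`, constraint sets `X, U`, disturbance radius `ε` (so that the disturbance
set is the closed ball of radius `ε`) and a set `E` that is to be disturbance invariant. -/
structure MPCData (dx du : ℕ) where
  A : Matrix (Fin dx) (Fin dx) ℝ
  B : Matrix (Fin dx) (Fin du) ℝ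
  Q : Matrix (Fin dx) (Fin dx) ℝ
  R : Matrix (Fin du) (Fin du) ℝ
  P : Matrix (Fin dx) (Fin dx) ℝ
  N : ℕ
  X : Set (Vec dx)
  U : Set (Vec du)
  ε : ℝ
  E : Set (Vec dx)

namespace MPCData

variable {dx du : ℕ} (S : MPCData dx du)

/-- One step `A x + B u` of the dynamics. -/
def step (x : Vec dx) (u : Vec du) : Vec dx :=
  WithLp.toLp 2 (S.A *ᵥ x.ofLp + S.B *ᵥ u.ofLp)

/-- The LQR gain `K = -(R + Bᵀ P B)⁻¹ Bᵀ P A`. -/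
def K : Matrix (Fin du) (Fin dx) ℝ :=
  -((S.R + S.Bᵀ * S.P * S.B)⁻¹ * S.Bᵀ * S.P * S.A)

/-- The unconstrained LQR controller `x ↦ K x`. -/
def lqr : Policy dx du := fun x => WithLp.toLp 2 (S.K *ᵥ x.ofLp)

/-- The discrete algebraic Riccati equation. -/
def Riccati : Prop :=
  S.P = S.Aᵀ * S.P * S.A
    - S.Aᵀ * S.P * S.B * (S.R + S.Bᵀ * S.P * S.B)⁻¹ * S.Bᵀ * S.P * S.A + S.Q

/-- `E` is disturbance invariant for the closed ball `W` of radius `ε`: it is a neighbourhood of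
the origin with `(A + B K) E + W ⊆ E`. -/
def IsDisturbanceInvariant : Prop :=
  S.E ∈ nhds (0 : Vec dx) ∧
    ∀ e ∈ S.E, ∀ w ∈ Metric.closedBall (0 : Vec dx) S.ε, S.step e (S.lqr e) + w ∈ S.E

/-- Standing assumptions: `Q ⪰ 0`, `R ≻ 0`, `P` is a positive definite solution of the Riccati
equation, the horizon is nonempty, `X` and `U` are closed and contain the origin, `U` is bounded
(so that `sup_{u ∈ U} ‖u‖` is finite) and `E` is disturbance invariant. -/
structure Standing : Prop where
  Q_psd : S.Q.PosSemidef
  R_pd : S.R.PosDef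
  P_pd : S.P.PosDef
  riccati : S.Riccati
  N_pos : 1 ≤ S.N
  X_closed : IsClosed S.X
  X_zero : (0 : Vec dx) ∈ S.X
  U_closed : IsClosed S.U
  U_zero : (0 : Vec du) ∈ S.U
  U_bdd : Bornology.IsBounded S.U
  E_inv : S.IsDisturbanceInvariant

/-- `sup_{u ∈ U} ‖u‖`. -/
def inputBound : ℝ := sSup ((fun u : Vec du => ‖u‖) '' S.U)

/-! ### Constraint sets, terminal set and the robust MPC controller -/

/-- The tightened state constraints `X ⊖ E`. -/
def Xbar : Set (Vec dx) := erode S.X S.E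

/-- The tightened input constraints `U ⊖ K E`. -/
def Ubar : Set (Vec du) := erode S.U (S.lqr '' S.E)

/-- State at time `t` of `x ↦ (A + B K) x` started at `x`. -/
def lqrTraj (x : Vec dx) : ℕ → Vec dx
  | 0 => x
  | t + 1 => S.step (lqrTraj x t) (S.lqr (lqrTraj x t))

/-- Positive invariance of `O` for the LQR controller with respect to `(X', U')`. -/
def IsPosInvariant (X' : Set (Vec dx)) (U' : Set (Vec du)) (O : Set (Vec dx)) : Prop :=
  O ⊆ X' ∧ ∀ x ∈ O, ∀ t, S.lqrTraj x t ∈ O ∧ S.lqr (S.lqrTraj x t) ∈ U'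

/-- The maximal positively invariant set: the union of all positively invariant sets. -/
def maxPosInvariant (X' : Set (Vec dx)) (U' : Set (Vec du)) : Set (Vec dx) :=
  ⋃₀ {O | S.IsPosInvariant X' U' O}

/-- The maximal positively invariant set for the tightened constraints, which is also the
terminal set of the tightened MPC problem. -/
def Obar : Set (Vec dx) := S.maxPosInvariant S.Xbar S.Ubar

/-- States that can be steered into the terminal set in `k` steps within the tightened
constraints. -/
def feasibleIn : ℕ → Set (Vec dx)
  | 0 => S.Obar
  | k + 1 => {x | x ∈ S.Xbar ∧ ∃ u ∈ S.Ubar, S.step x u ∈ feasibleIn k}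

/-- The feasible domain of the tightened MPC problem. -/
def feasibleDomain : Set (Vec dx) := S.feasibleIn S.N

/-- Nominal state at time `k` from `x₀` under the inputs `u 0, u 1, …`. -/
def nominal (x₀ : Vec dx) (u : ℕ → Vec du) : ℕ → Vec dx
  | 0 => x₀
  | k + 1 => S.step (nominal x₀ u k) (u k)

/-- The `N`-step objective with terminal cost `xᵀ P x`. Only `u 0, …, u (N - 1)` matter. -/
def cost (x₀ : Vec dx) (u : ℕ → Vec du) : ℝ :=
  (∑ k ∈ Finset.range S.N, (quad S.Q (S.nominal x₀ u k) + quad S.R (u k)))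
    + quad S.P (S.nominal x₀ u S.N)

/-- The constraints of the tightened MPC problem. -/
def MPCFeasible (x₀ : Vec dx) (u : ℕ → Vec du) : Prop :=
  (∀ k < S.N, S.nominal x₀ u k ∈ S.Xbar ∧ u k ∈ S.Ubar) ∧ S.nominal x₀ u S.N ∈ S.Obar

/-- The constraints of the robust MPC problem at the state `x`, with variables `x₀` and `u`. -/
def RMPCFeasible (x x₀ : Vec dx) (u : ℕ → Vec du) : Prop :=
  S.MPCFeasible x₀ u ∧ x - x₀ ∈ S.E

/-- `(x₀, u)` is an optimal solution of the robust MPC problem at the state `x`. -/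
def RMPCOptimal (x x₀ : Vec dx) (u : ℕ → Vec du) : Prop :=
  S.RMPCFeasible x x₀ u ∧ ∀ x₀' u', S.RMPCFeasible x x₀' u' → S.cost x₀ u ≤ S.cost x₀' u'

/-- The states at which the robust MPC problem is posed: the sum of the feasible domain and `E`,
intersected with `X`. -/
def rmpcDomain : Set (Vec dx) :=
  {x | x ∈ S.X ∧ ∃ x₀ ∈ S.feasibleDomain, x - x₀ ∈ S.E}

/-- `π` is the robust MPC controller: where the robust MPC problem is posed,
`π x = ū₀ + K (x - x̄₀)` for an optimal solution `(x̄₀, ū)`. Elsewhere `π` is any extension. -/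
def IsRobustMPC (π : Policy dx du) : Prop :=
  ∀ x ∈ S.rmpcDomain, ∃ (x₀ : Vec dx) (u : ℕ → Vec du),
    S.RMPCOptimal x x₀ u ∧ π x = u 0 + S.lqr (x - x₀)

/-! ### Trajectories and the time to reach the invariant set -/

/-- State at time `t` from `x₀` under the time-varying controller `π`. -/
def traj (π : ℕ → Policy dx du) (x₀ : Vec dx) : ℕ → Vec dx
  | 0 => x₀
  | t + 1 => S.step (traj π x₀ t) (π t (traj π x₀ t))

/-- State at time `t` from `x₀` under the controller `π` with additive disturbances `w`. -/
def disturbedTraj (π : Policy dx du) (w : ℕ → Vec dx) (x₀ : Vec dx) : ℕ → Vec dx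
  | 0 => x₀
  | t + 1 => S.step (disturbedTraj π w x₀ t) (π (disturbedTraj π w x₀ t)) + w t

/-- The positive times at which the closed loop with `π` is in the invariant set for almost all
initial states, whatever the disturbances of norm at most `ε`. -/
def reachTimes (D : Measure (Vec dx)) (π : Policy dx du) : Set ℕ :=
  {τ | 1 ≤ τ ∧ ∀ᵐ x₀ ∂D, ∀ w : ℕ → Vec dx, (∀ t, ‖w t‖ ≤ S.ε) →
    S.disturbedTraj π w x₀ τ ∈ S.Obar}

/-- The least such time (`⊤` if there is none). -/
def tauStar (D : Measure (Vec dx)) (π : Policy dx du) : ℕ∞ :=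
  ⨅ τ ∈ S.reachTimes D π, (τ : ℕ∞)

/-! ### The algorithm -/

/-- The switching time: the first `t + 1` such that, at the end of stage `t`, all the `ℓ` fresh
trajectories with initial states `v t i` are in the invariant set at time `t + 1`; it is `T` if
this does not happen up to time `T`. -/
def switchTime (T ℓ : ℕ) (π : ℕ → Policy dx du) (v : ℕ → Fin ℓ → Vec dx) : ℕ :=
  sInf ({τ | ∃ t, τ = t + 1 ∧ ∀ i, S.traj π (v t i) (t + 1) ∈ S.Obar} ∪ {T})

/-- The switched controller: the learned one before time `τ`, LQR from then on. -/
def switched (π : ℕ → Policy dx du) (τ : ℕ) : ℕ → Policy dx du :=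
  fun t => if t < τ then π t else S.lqr

/-- Empirical imitation loss at stage `t` of the candidate `p`, over the initial states `x i`, when
`π` are the policies learned so far. -/
def empLoss (expert : Policy dx du) (π : ℕ → Policy dx du) (t : ℕ) {m : ℕ}
    (x : Fin m → Vec dx) (p : Policy dx du) : ℝ :=
  (1 / (m : ℝ)) * ∑ i, ‖expert (S.traj π (x i) t) - p (S.traj π (x i) t)‖

end MPCData

/-- `c = ∑_{t ≥ 1} 1 / (t ln² (t + 1))`. -/
def sampleConst : ℝ := ∑' k : ℕ, 1 / (((k : ℝ) + 1) * Real.log ((k : ℝ) + 2) ^ 2)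

/-- The number of samples at stage `t`: `c n t ⌈ln² (t + 1)⌉ + n`, rounded up. -/
def sampleSize (n t : ℕ) : ℕ :=
  ⌈sampleConst * (n : ℝ) * (t : ℝ) * (⌈Real.log ((t : ℝ) + 1) ^ 2⌉₊ : ℝ) + (n : ℝ)⌉₊

/-- A run of Forward-Switch on the probability space `(Ω, μ)`, with base sample size `n`, horizon
`T`, `ℓ` test trajectories per stage, finite policy class `Pol`, expert `expert` and initial
distribution `D`. -/
structure ForwardSwitch {dx du : ℕ} (S : MPCData dx du) (D : Measure (Vec dx))
    (Pol : Finset (Policy dx du)) (expert : Policy dx du) (n T ℓ : ℕ)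
    {Ω : Type*} [mΩ : MeasurableSpace Ω] (μ : Measure Ω) where
  /-- Initial states drawn for training at stage `t`. -/
  train : (t : ℕ) → Ω → Fin (sampleSize n t) → Vec dx
  /-- Initial states drawn for the test at the end of stage `t`. -/
  test : ℕ → Ω → Fin ℓ → Vec dx
  /-- The policy learned at stage `t`. From the switching time on it is not used. -/
  policy : ℕ → Ω → Policy dx du
  /-- What is known when stage `t` begins. -/
  before : ℕ → MeasurableSpace Ω
  /-- What is known once the policy of stage `t` has been learned. -/
  after : ℕ → MeasurableSpace Ω
  before_le_after : ∀ t, before t ≤ after t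
  after_le_before : ∀ t, after t ≤ before (t + 1)
  after_le : ∀ t, after t ≤ mΩ
  /-- The training samples of a stage are i.i.d. from `D` and fresh. -/
  train_meas : ∀ t, Measurable[after t] (train t)
  train_law : ∀ t, μ.map (train t) = Measure.pi fun _ => D
  train_indep : ∀ t, Indep (MeasurableSpace.comap (train t) inferInstance) (before t) μ
  /-- The test samples of a stage are i.i.d. from `D` and fresh. -/
  test_meas : ∀ t, Measurable[before (t + 1)] (test t)
  test_law : ∀ t, μ.map (test t) = Measure.pi fun _ => D
  test_indep : ∀ t, Indep (MeasurableSpace.comap (test t) inferInstance) (after t) μ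
  /-- The policy of stage `t` is chosen in `Pol` from what is known at the end of stage `t`. -/
  policy_mem : ∀ t ω, policy t ω ∈ Pol
  policy_meas : ∀ t, ∀ p ∈ Pol, MeasurableSet[after t] {ω | policy t ω = p}
  /-- As long as the switch has not occurred, it minimizes the empirical loss over `Pol`. -/
  erm : ∀ t ω, t < S.switchTime T ℓ (fun s => policy s ω) (fun s => test s ω) →
    ∀ p ∈ Pol, S.empLoss expert (fun s => policy s ω) t (train t ω) (policy t ω)
      ≤ S.empLoss expert (fun s => policy s ω) t (train t ω) p

namespace ForwardSwitch

variable {dx du : ℕ} {S : MPCData dx du} {D : Measure (Vec dx)} {Pol : Finset (Policy dx du)}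
  {expert : Policy dx du} {n T ℓ : ℕ} {Ω : Type*} [MeasurableSpace Ω] {μ : Measure Ω}
  (F : ForwardSwitch S D Pol expert n T ℓ μ)

/-- The learned time-varying controller. -/
def learned (ω : Ω) : ℕ → Policy dx du := fun t => F.policy t ω

/-- The switching time of the run. -/
def tauHat (ω : Ω) : ℕ := S.switchTime T ℓ (F.learned ω) (fun t => F.test t ω)

/-- The initial states from which the learned controller is in the invariant set at the
switching time. -/
def reachEvent (ω : Ω) : Set (Vec dx) :=
  {x₀ | S.traj (F.learned ω) x₀ (F.tauHat ω) ∈ S.Obar}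

/-- The initial states from which the learned inputs are within `ε / ‖B‖` of the expert's before
the switching time; there is no condition if `B = 0`. -/
def closeEvent (ω : Ω) : Set (Vec dx) :=
  {x₀ | ∀ t < F.tauHat ω,
    ‖S.B‖ * ‖expert (S.traj (F.learned ω) x₀ t) - F.learned ω t (S.traj (F.learned ω) x₀ t)‖
      ≤ S.ε}

/-- The output of the algorithm. -/
def output (ω : Ω) : ℕ → Policy dx du := S.switched (F.learned ω) (F.tauHat ω)

end ForwardSwitch

end

/-! An input error is an additive disturbance: if `‖B‖‖π_t(x_t) - expert(x_t)‖ ≤ ε` before time `τ`,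
the learned trajectory is up to `τ` a disturbed trajectory of the expert
(`exists_disturbedTraj_eq`). Closeness therefore transfers to the learner both robust recursive
feasibility, hence safety until the switch, and arrival in `Obar` at any reaching time of the
expert; LQR invariance of `Obar` takes over after the switch.

Closeness is a realizable learning problem. Since the expert is in `Pol`, empirical minimizers have
zero loss and agree exactly with the expert on fresh samples. A union bound over `Pol` gives
disagreement at most `log a / n_t` at stage `t`, with `a = 2Tℓ|Pol|/δ`. The choice of `n_t` makes
these sum to `2δ/(7ℓ)`, whatever the horizon.

Three bad events are excluded, with probabilities `δ/2`, `δ` and `δ`: a misleading training sample,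
a test passed by a controller that reaches `Obar` too rarely, and a failed test at the expert's
reaching time. The last costs only `ℓ · 2δ/(7ℓ)`, because it concerns a single stage.

Finiteness of `tauStar` is a Lyapunov argument: the optimal cost decreases along every disturbed
closed loop and bounds the nominal state. -/

/-! ### Bounds for quadratic forms. -/

section QuadraticForms

variable {d : ℕ}

lemma quad_eq_inner (M : Matrix (Fin d) (Fin d) ℝ) (x : Vec d) :
    quad M x = inner ℝ x (WithLp.toLp 2 (M *ᵥ x.ofLp) : Vec d) := by
  rw [EuclideanSpace.inner_eq_star_dotProduct, quad, dotProduct_comm]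
  simp

lemma quad_le_norm_mul_sq (M : Matrix (Fin d) (Fin d) ℝ) (x : Vec d) :
    quad M x ≤ ‖M‖ * ‖x‖ ^ 2 := by
  rw [quad_eq_inner]
  calc _ ≤ ‖x‖ * ‖(WithLp.toLp 2 (M *ᵥ x.ofLp) : Vec d)‖ := real_inner_le_norm _ _
    _ ≤ ‖x‖ * (‖M‖ * ‖x‖) := by gcongr; exact M.l2_opNorm_mulVec x
    _ = _ := by ring

lemma quad_smul (M : Matrix (Fin d) (Fin d) ℝ) (a : ℝ) (x : Vec d) :
    quad M (a • x) = a ^ 2 * quad M x := by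
  simp only [quad, WithLp.ofLp_smul, Matrix.mulVec_smul, smul_dotProduct, dotProduct_smul,
    smul_eq_mul]
  ring

lemma quad_nonneg {M : Matrix (Fin d) (Fin d) ℝ} (hM : M.PosSemidef) (x : Vec d) :
    0 ≤ quad M x := by
  simpa [quad] using hM.dotProduct_mulVec_nonneg x.ofLp

lemma continuous_quad (M : Matrix (Fin d) (Fin d) ℝ) : Continuous (quad M) := by
  unfold quad
  fun_prop

/-- By homogeneity the constant is the minimum over the unit sphere, which is empty in dimension
`0`. -/
lemma exists_pos_mul_sq_le_quad {M : Matrix (Fin d) (Fin d) ℝ} (hM : M.PosDef) :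
    ∃ c > 0, ∀ x, c * ‖x‖ ^ 2 ≤ quad M x := by
  obtain hne | hne := (Metric.sphere (0 : Vec d) 1).eq_empty_or_nonempty
  · refine ⟨1, one_pos, fun x => ?_⟩
    have hx : x = 0 := by
      by_contra hx
      have : (‖x‖⁻¹ • x) ∈ Metric.sphere (0 : Vec d) 1 := by
        simp [norm_smul, hx]
      rw [hne] at this
      exact this
    simpa [hx] using quad_nonneg hM.posSemidef 0
  · obtain ⟨y, hy, hmin⟩ := (isCompact_sphere (0 : Vec d) 1).exists_isMinOn hne
      (continuous_quad M).continuousOn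
    have hy0 : y ≠ 0 := by
      rintro rfl
      simp at hy
    refine ⟨quad M y, by simpa [quad] using hM.dotProduct_mulVec_pos (x := y.ofLp) (by simpa), ?_⟩
    intro x
    by_cases hx : x = 0
    · simpa [hx] using quad_nonneg hM.posSemidef 0
    have h1 : quad M y ≤ quad M (‖x‖⁻¹ • x) := hmin (by simp [norm_smul, hx])
    rw [quad_smul] at h1
    have hx' : 0 < ‖x‖ := norm_pos_iff.2 hx
    calc quad M y * ‖x‖ ^ 2 ≤ (‖x‖⁻¹ ^ 2 * quad M x) * ‖x‖ ^ 2 := by gcongr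
      _ = quad M x := by field_simp

end QuadraticForms

lemma isClosed_erode {d : ℕ} {X Y : Set (Vec d)} (hX : IsClosed X) : IsClosed (erode X Y) := by
  have : erode X Y = X ∩ ⋂ y ∈ Y, (fun x => x + y) ⁻¹' X := by
    ext x
    simp [erode]
  rw [this]
  exact hX.inter (isClosed_biInter fun y _ => hX.preimage (by fun_prop))

/-! ### Linear dynamics and the terminal set. -/

namespace MPCData

variable {dx du : ℕ} {S : MPCData dx du}

section Dynamics

lemma step_add_add (x x' : Vec dx) (u u' : Vec du) :
    S.step (x + x') (u + u') = S.step x u + S.step x' u' := by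
  ext i
  simp [step, Matrix.mulVec_add]
  ring

/-- This is what turns an imitation error into a disturbance. -/
lemma step_eq_add (x : Vec dx) (u v : Vec du) :
    S.step x u = S.step x v + WithLp.toLp 2 (S.B *ᵥ (u - v).ofLp) := by
  ext i
  simp [step, Matrix.mulVec_sub]

lemma continuous_lqr : Continuous S.lqr := by
  unfold lqr
  fun_prop

lemma continuous_step : Continuous fun p : Vec dx × Vec du => S.step p.1 p.2 := by
  unfold step
  fun_prop

lemma norm_step_le (x : Vec dx) (u : Vec du) : ‖S.step x u‖ ≤ ‖S.A‖ * ‖x‖ + ‖S.B‖ * ‖u‖ := by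
  have h : S.step x u = WithLp.toLp 2 (S.A *ᵥ x.ofLp) + WithLp.toLp 2 (S.B *ᵥ u.ofLp) := rfl
  rw [h]
  exact (norm_add_le _ _).trans
    (add_le_add (S.A.l2_opNorm_mulVec x) (S.B.l2_opNorm_mulVec u))

lemma lqrTraj_add (x : Vec dx) (t s : ℕ) :
    S.lqrTraj (S.lqrTraj x t) s = S.lqrTraj x (t + s) := by
  induction s with
  | zero => rfl
  | succ s ih => rw [lqrTraj, ih]; rfl

lemma continuous_lqrTraj (t : ℕ) : Continuous fun x => S.lqrTraj x t := by
  induction t with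
  | zero => exact continuous_id
  | succ t ih =>
    exact continuous_step.comp (ih.prodMk (continuous_lqr.comp ih))

lemma nominal_succ_eq (x : Vec dx) (u : ℕ → Vec du) (k : ℕ) :
    S.nominal x u (k + 1) = S.nominal (S.step x (u 0)) (fun j => u (j + 1)) k := by
  induction k with
  | zero => rfl
  | succ k ih => rw [nominal, ih]; rfl

lemma nominal_congr {x : Vec dx} {u v : ℕ → Vec du} {k : ℕ} (h : ∀ j < k, u j = v j) :
    S.nominal x u k = S.nominal x v k := by
  induction k with
  | zero => rfl
  | succ k ih =>
    rw [nominal, nominal, ih fun j hj => h j (hj.trans k.lt_succ_self), h k k.lt_succ_self]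

lemma nominal_lqr (x : Vec dx) (k : ℕ) :
    S.nominal x (fun j => S.lqr (S.lqrTraj x j)) k = S.lqrTraj x k := by
  induction k with
  | zero => rfl
  | succ k ih => rw [nominal, ih]; rfl

lemma exists_norm_nominal_le (S : MPCData dx du) (r b : ℝ) (k : ℕ) :
    ∃ c, ∀ x u, ‖x‖ ≤ r → (∀ j < k, ‖u j‖ ≤ b) → ‖S.nominal x u k‖ ≤ c := by
  induction k with
  | zero => exact ⟨r, fun x u hx _ => hx⟩
  | succ k ih =>
    obtain ⟨c, hc⟩ := ih
    refine ⟨‖S.A‖ * c + ‖S.B‖ * b, fun x u hx hu => ?_⟩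
    refine (norm_step_le _ _).trans ?_
    gcongr
    · exact hc x u hx fun j hj => hu j (hj.trans k.lt_succ_self)
    · exact hu k k.lt_succ_self

end Dynamics

section TerminalSet

/-- The states whose whole LQR orbit meets the constraints form an invariant set themselves, so the
union of all invariant sets reduces to a pointwise condition. Closedness and invariance of `Obar`
follow from it. -/
lemma mem_Obar_iff {x : Vec dx} :
    x ∈ S.Obar ↔ ∀ t, S.lqrTraj x t ∈ S.Xbar ∧ S.lqr (S.lqrTraj x t) ∈ S.Ubar := by
  constructor
  · rintro ⟨O, ⟨hOX, hO⟩, hx⟩ t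
    exact ⟨hOX (hO x hx t).1, (hO x hx t).2⟩
  · intro h
    refine ⟨{y | ∀ t, S.lqrTraj y t ∈ S.Xbar ∧ S.lqr (S.lqrTraj y t) ∈ S.Ubar},
      ⟨fun y hy => (hy 0).1, fun y hy t => ⟨fun s => ?_, (hy t).2⟩⟩, h⟩
    rw [lqrTraj_add]
    exact hy _

lemma Obar_subset_Xbar : S.Obar ⊆ S.Xbar := fun _ hx => (mem_Obar_iff.1 hx 0).1

lemma lqr_mem_Ubar {x : Vec dx} (hx : x ∈ S.Obar) : S.lqr x ∈ S.Ubar := (mem_Obar_iff.1 hx 0).2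

lemma lqrTraj_mem_Obar {x : Vec dx} (hx : x ∈ S.Obar) (t : ℕ) : S.lqrTraj x t ∈ S.Obar := by
  rw [mem_Obar_iff] at hx ⊢
  intro s
  rw [lqrTraj_add]
  exact hx _

lemma isClosed_Obar (hS : S.Standing) : IsClosed S.Obar := by
  have : S.Obar = ⋂ t, ((fun x => S.lqrTraj x t) ⁻¹' S.Xbar ∩
      (fun x => S.lqr (S.lqrTraj x t)) ⁻¹' S.Ubar) := by
    ext x
    simp [mem_Obar_iff]
  rw [this]
  exact isClosed_iInter fun t =>
    ((isClosed_erode hS.X_closed).preimage (continuous_lqrTraj t)).inter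
      ((isClosed_erode hS.U_closed).preimage (continuous_lqr.comp (continuous_lqrTraj t)))

end TerminalSet

/-! ### Recursive feasibility of the nominal problem. -/

section Feasibility

lemma mem_feasibleIn_iff {k : ℕ} {x : Vec dx} :
    x ∈ S.feasibleIn k ↔ ∃ u : ℕ → Vec du,
      (∀ j < k, S.nominal x u j ∈ S.Xbar ∧ u j ∈ S.Ubar) ∧ S.nominal x u k ∈ S.Obar := by
  induction k generalizing x with
  | zero => simp [feasibleIn, nominal]
  | succ k ih =>
    constructor
    · rintro ⟨hx, u₀, hu₀, h⟩
      obtain ⟨u, hu, hO⟩ := ih.1 h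
      refine ⟨fun j => Nat.casesOn j u₀ u, ?_, ?_⟩
      · rintro (_ | j) hj
        · exact ⟨hx, hu₀⟩
        · rw [nominal_succ_eq]
          exact hu j (by omega)
      · rw [nominal_succ_eq]
        exact hO
    · rintro ⟨u, hu, hO⟩
      refine ⟨(hu 0 k.succ_pos).1, u 0, (hu 0 k.succ_pos).2, ih.2 ⟨fun j => u (j + 1), ?_, ?_⟩⟩
      · intro j hj
        rw [← nominal_succ_eq]
        exact ⟨(hu (j + 1) (by omega)).1, (hu (j + 1) (by omega)).2⟩
      · rw [← nominal_succ_eq]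
        exact hO

lemma mem_feasibleDomain_iff {x : Vec dx} :
    x ∈ S.feasibleDomain ↔ ∃ u, S.MPCFeasible x u := mem_feasibleIn_iff

lemma feasibleIn_subset_Xbar (k : ℕ) : S.feasibleIn k ⊆ S.Xbar := by
  cases k with
  | zero => exact Obar_subset_Xbar
  | succ k => exact fun x hx => hx.1

lemma feasibleDomain_subset_rmpcDomain (hS : S.Standing) : S.feasibleDomain ⊆ S.rmpcDomain :=
  fun x hx => ⟨(feasibleIn_subset_Xbar _ hx).1, x, hx, by
    simpa using mem_of_mem_nhds hS.E_inv.1⟩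

/-- The input sequence `u` without its first entry, continued by the LQR input. -/
noncomputable def shiftInputs (S : MPCData dx du) (x : Vec dx) (u : ℕ → Vec du) : ℕ → Vec du :=
  fun k => if k + 1 < S.N then u (k + 1) else S.lqr (S.nominal x u S.N)

lemma nominal_shiftInputs {x : Vec dx} {u : ℕ → Vec du} {k : ℕ} (hk : k + 1 ≤ S.N) :
    S.nominal (S.step x (u 0)) (S.shiftInputs x u) k = S.nominal x u (k + 1) := by
  rw [nominal_succ_eq]
  refine nominal_congr fun j hj => ?_
  rw [shiftInputs, if_pos (by omega)]

lemma shiftInputs_last {x : Vec dx} {u : ℕ → Vec du} {M : ℕ} (hM : S.N = M + 1) :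
    S.shiftInputs x u M = S.lqr (S.nominal x u S.N) := by
  rw [shiftInputs, if_neg (by omega)]

lemma nominal_shiftInputs_last (hS : S.Standing) {x : Vec dx} {u : ℕ → Vec du} :
    S.nominal (S.step x (u 0)) (S.shiftInputs x u) S.N =
      S.step (S.nominal x u S.N) (S.lqr (S.nominal x u S.N)) := by
  obtain ⟨M, hM⟩ := Nat.exists_eq_add_of_le' hS.N_pos
  conv_lhs => rw [hM, nominal, shiftInputs_last hM, nominal_shiftInputs (by omega), ← hM]

lemma MPCFeasible.shift (hS : S.Standing) {x : Vec dx} {u : ℕ → Vec du}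
    (h : S.MPCFeasible x u) : S.MPCFeasible (S.step x (u 0)) (S.shiftInputs x u) := by
  refine ⟨fun k hk => ⟨?_, ?_⟩, ?_⟩
  · rw [nominal_shiftInputs hk]
    -- At `k + 1 = N` the state is the old terminal one, which satisfies the constraints because
    -- `Obar ⊆ Xbar`.
    rcases (Nat.succ_le_of_lt hk).lt_or_eq with hk' | hk'
    · exact (h.1 _ hk').1
    · have := Obar_subset_Xbar h.2
      rwa [← hk'] at this
  · unfold shiftInputs
    split_ifs with hk'
    · exact (h.1 _ hk').2
    · exact lqr_mem_Ubar h.2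
  · rw [nominal_shiftInputs_last hS]
    exact lqrTraj_mem_Obar h.2 1

end Feasibility

/-! ### The Riccati equation and the cost. -/

section Riccati

lemma quad_eq_of_matrix_eq {d e : ℕ} {M : Matrix (Fin d) (Fin d) ℝ} {L : Matrix (Fin e) (Fin d) ℝ}
    {M' : Matrix (Fin e) (Fin e) ℝ} (x : Vec d) (h : M = Lᵀ * M' * L) :
    quad M x = quad M' (WithLp.toLp 2 (L *ᵥ x.ofLp)) := by
  simp only [quad, h, ← Matrix.mulVec_mulVec]
  rw [Matrix.dotProduct_mulVec, Matrix.vecMul_transpose]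

/-- The Riccati equation in closed-loop form. -/
lemma riccati_closedLoop (hS : S.Standing) :
    S.P = S.Q + S.Kᵀ * S.R * S.K + (S.A + S.B * S.K)ᵀ * S.P * (S.A + S.B * S.K) := by
  have hPT : S.Pᵀ = S.P := by simpa using hS.P_pd.isHermitian.eq
  have hRT : S.Rᵀ = S.R := by simpa using hS.R_pd.isHermitian.eq
  have hBPB : (S.Bᵀ * S.P * S.B).PosSemidef := by
    simpa using hS.P_pd.posSemidef.conjTranspose_mul_mul_same S.B
  set M := S.R + S.Bᵀ * S.P * S.B with hM
  have hMdet : IsUnit M.det :=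
    (Matrix.isUnit_iff_isUnit_det _).1 (hS.R_pd.add_posSemidef hBPB).isUnit
  have hMT : Mᵀ = M := by
    simp [hM, hRT, hPT, Matrix.mul_assoc]
  have hMK : M * S.K = -(S.Bᵀ * S.P * S.A) := by
    rw [K, ← hM]
    simp only [Matrix.mul_neg, Matrix.mul_assoc]
    rw [Matrix.mul_nonsing_inv_cancel_left _ _ hMdet]
  have hKT : S.Kᵀ * S.Bᵀ * S.P * S.A = S.Aᵀ * S.P * S.B * S.K := by
    have h1 : S.Bᵀ * S.P * S.A = -(M * S.K) := by rw [hMK, neg_neg]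
    have h2 : S.Aᵀ * S.P * S.B = -(S.Kᵀ * M) := by
      have := congrArg Matrix.transpose h1
      simpa [hPT, hMT, Matrix.mul_assoc] using this
    rw [Matrix.mul_assoc, Matrix.mul_assoc, ← Matrix.mul_assoc S.Bᵀ, h1, h2]
    simp [Matrix.mul_assoc]
  have hR : S.R = M - S.Bᵀ * S.P * S.B := by rw [hM]; abel
  have hRic : S.P = S.Aᵀ * S.P * S.A + S.Aᵀ * S.P * S.B * S.K + S.Q := by
    conv_lhs => rw [hS.riccati]
    simp only [K, Matrix.mul_neg, Matrix.mul_assoc, sub_eq_add_neg]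
  -- The quadratic term in `K` cancels one of the two cross terms of the expansion; the other is the
  -- one in the Riccati equation.
  have hKMK : S.Kᵀ * M * S.K = -(S.Kᵀ * S.Bᵀ * S.P * S.A) := by
    rw [Matrix.mul_assoc, hMK]
    simp [Matrix.mul_assoc]
  have hexp : S.Q + S.Kᵀ * S.R * S.K + (S.A + S.B * S.K)ᵀ * S.P * (S.A + S.B * S.K)
      = S.Q + S.Kᵀ * M * S.K + S.Aᵀ * S.P * S.A + S.Aᵀ * S.P * S.B * S.K
        + S.Kᵀ * S.Bᵀ * S.P * S.A := by
    rw [hR]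
    simp only [Matrix.transpose_add, Matrix.transpose_mul, Matrix.add_mul, Matrix.mul_add,
      Matrix.mul_sub, Matrix.sub_mul, Matrix.mul_assoc]
    abel
  rw [hexp, hKMK]
  conv_lhs => rw [hRic]
  abel

lemma quad_riccati (hS : S.Standing) (x : Vec dx) :
    quad S.Q x + quad S.R (S.lqr x) + quad S.P (S.step x (S.lqr x)) = quad S.P x := by
  have hstep : S.step x (S.lqr x) = WithLp.toLp 2 ((S.A + S.B * S.K) *ᵥ x.ofLp) := by
    simp [step, lqr, Matrix.add_mulVec, Matrix.mulVec_mulVec]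
  have h1 : quad (S.Kᵀ * S.R * S.K) x = quad S.R (S.lqr x) := quad_eq_of_matrix_eq x rfl
  have h2 := quad_eq_of_matrix_eq (L := S.A + S.B * S.K) (M' := S.P) x rfl
  rw [hstep, ← h1, ← h2]
  conv_rhs => rw [riccati_closedLoop hS]
  simp [quad, Matrix.add_mulVec, dotProduct_add]

/-- By `quad_riccati`, the LQR stage appended at the end costs exactly what the terminal cost loses,
so only the dropped first stage remains. -/
lemma cost_shiftInputs (hS : S.Standing) (x : Vec dx) (u : ℕ → Vec du) :
    S.cost (S.step x (u 0)) (S.shiftInputs x u) + (quad S.Q x + quad S.R (u 0)) = S.cost x u := by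
  have hlast := nominal_shiftInputs_last hS (x := x) (u := u)
  obtain ⟨M, hM⟩ := Nat.exists_eq_add_of_le' hS.N_pos
  unfold cost
  rw [hlast, hM, Finset.sum_range_succ, Finset.sum_range_succ' _ M, shiftInputs_last hM,
    nominal_shiftInputs (by omega), hM]
  have hsum : ∑ k ∈ Finset.range M, (quad S.Q (S.nominal (S.step x (u 0)) (S.shiftInputs x u) k)
        + quad S.R (S.shiftInputs x u k))
      = ∑ k ∈ Finset.range M, (quad S.Q (S.nominal x u (k + 1)) + quad S.R (u (k + 1))) := by
    refine Finset.sum_congr rfl fun k hk => ?_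
    rw [Finset.mem_range] at hk
    rw [nominal_shiftInputs (by omega), shiftInputs, if_pos (by omega)]
  rw [hsum]
  have := quad_riccati hS (S.nominal x u (M + 1))
  simp only [nominal] at this ⊢
  linarith

/-- Telescoping `quad_riccati`. It bounds the optimal cost by the `P`-form once the nominal state is
in `Obar`. -/
lemma cost_lqr (hS : S.Standing) (x : Vec dx) :
    S.cost x (fun k => S.lqr (S.lqrTraj x k)) = quad S.P x := by
  have h : ∀ m, (∑ k ∈ Finset.range m, (quad S.Q (S.lqrTraj x k)
      + quad S.R (S.lqr (S.lqrTraj x k)))) + quad S.P (S.lqrTraj x m) = quad S.P x := by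
    intro m
    induction m with
    | zero => simp [lqrTraj]
    | succ m ih =>
      rw [Finset.sum_range_succ, ← ih, lqrTraj]
      linarith [quad_riccati hS (S.lqrTraj x m)]
  simp only [cost, nominal_lqr]
  exact h _

lemma quad_le_cost (hS : S.Standing) (x : Vec dx) (u : ℕ → Vec du) : quad S.Q x ≤ S.cost x u := by
  have hnn : ∀ k, 0 ≤ quad S.Q (S.nominal x u k) + quad S.R (u k) := fun k =>
    add_nonneg (quad_nonneg hS.Q_psd _) (quad_nonneg hS.R_pd.posSemidef _)
  have h0 := Finset.single_le_sum (fun k _ => hnn k) (Finset.mem_range.2 hS.N_pos)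
  have h1 := quad_nonneg hS.R_pd.posSemidef (u 0)
  have h2 := quad_nonneg hS.P_pd.posSemidef (S.nominal x u S.N)
  simp only [nominal] at h0
  unfold cost
  linarith

lemma exists_cost_le (hS : S.Standing) (r : ℝ) :
    ∃ c, ∀ x u, ‖x‖ ≤ r → S.MPCFeasible x u → S.cost x u ≤ c := by
  obtain ⟨b, hb⟩ := hS.U_bdd.exists_norm_le
  choose c hc using S.exists_norm_nominal_le r b
  refine ⟨∑ k ∈ Finset.range S.N, (‖S.Q‖ * c k ^ 2 + ‖S.R‖ * b ^ 2) + ‖S.P‖ * c S.N ^ 2,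
    fun x u hx hu => ?_⟩
  have hub : ∀ k < S.N, ‖u k‖ ≤ b := fun k hk => hb _ (hu.1 k hk).2.1
  have hxb : ∀ k ≤ S.N, ‖S.nominal x u k‖ ≤ c k := fun k hk =>
    hc k x u hx fun j hj => hub j (hj.trans_le hk)
  refine add_le_add (Finset.sum_le_sum fun k hk => ?_) ?_
  · rw [Finset.mem_range] at hk
    refine add_le_add ((quad_le_norm_mul_sq _ _).trans ?_) ((quad_le_norm_mul_sq _ _).trans ?_)
    · gcongr; exact hxb k hk.le
    · gcongr; exact hub k hk
  · refine (quad_le_norm_mul_sq _ _).trans ?_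
    gcongr
    exact hxb _ le_rfl

end Riccati

/-! ### Robust invariance and finite reaching time of the expert. -/

section RobustMPC

/-- One step of the perturbed closed loop: the shifted inputs stay feasible. -/
lemma RMPCFeasible.shift (hS : S.Standing) {x x₀ : Vec dx} {u : ℕ → Vec du}
    (h : S.RMPCFeasible x x₀ u) {w : Vec dx} (hw : ‖w‖ ≤ S.ε) :
    S.RMPCFeasible (S.step x (u 0 + S.lqr (x - x₀)) + w) (S.step x₀ (u 0))
      (S.shiftInputs x₀ u) := by
  refine ⟨h.1.shift hS, ?_⟩
  -- By linearity the error `x - x₀` evolves under `A + BK` and `w` alone, so it stays in `E`.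
  have hx : S.step x (u 0 + S.lqr (x - x₀)) =
      S.step x₀ (u 0) + S.step (x - x₀) (S.lqr (x - x₀)) := by
    rw [← step_add_add, add_sub_cancel]
  rw [hx, add_assoc, add_sub_cancel_left]
  exact hS.E_inv.2 _ h.2 w (by simpa using hw)

lemma RMPCFeasible.mem_rmpcDomain {x x₀ : Vec dx} {u : ℕ → Vec du} (h : S.RMPCFeasible x x₀ u) :
    x ∈ S.rmpcDomain := by
  have hx₀ : x₀ ∈ S.feasibleDomain := mem_feasibleDomain_iff.2 ⟨u, h.1⟩
  refine ⟨?_, x₀, hx₀, h.2⟩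
  have := (feasibleIn_subset_Xbar _ hx₀).2 _ h.2
  rwa [add_sub_cancel] at this

variable {expert : Policy dx du}

lemma IsRobustMPC.step_mem_rmpcDomain (hS : S.Standing) (hexpert : S.IsRobustMPC expert)
    {x w : Vec dx} (hx : x ∈ S.rmpcDomain) (hw : ‖w‖ ≤ S.ε) :
    S.step x (expert x) + w ∈ S.rmpcDomain := by
  obtain ⟨x₀, u, hopt, hπ⟩ := hexpert x hx
  rw [hπ]
  exact (hopt.1.shift hS hw).mem_rmpcDomain

lemma IsRobustMPC.disturbedTraj_mem_rmpcDomain (hS : S.Standing) (hexpert : S.IsRobustMPC expert)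
    {x₀ : Vec dx} (hx₀ : x₀ ∈ S.rmpcDomain) {w : ℕ → Vec dx} (hw : ∀ t, ‖w t‖ ≤ S.ε) (t : ℕ) :
    S.disturbedTraj expert w x₀ t ∈ S.rmpcDomain := by
  induction t with
  | zero => exact hx₀
  | succ t ih => exact hexpert.step_mem_rmpcDomain hS ih (hw t)

/-- Along the perturbed closed loop the optimal cost is a Lyapunov function of the nominal state,
which therefore gets close to the origin within a uniform time and stays there. -/
lemma IsRobustMPC.exists_forall_disturbedTraj_mem_Obar (hS : S.Standing)
    (hexpert : S.IsRobustMPC expert) (hQ : S.Q.PosDef)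
    (h0 : (0 : Vec dx) ∈ interior (erode S.Obar S.E)) (b : ℝ) :
    ∃ τ ≥ 1, ∀ x₀ ∈ S.feasibleDomain, ‖x₀‖ ≤ b → ∀ w : ℕ → Vec dx, (∀ t, ‖w t‖ ≤ S.ε) →
      S.disturbedTraj expert w x₀ τ ∈ S.Obar := by
  obtain ⟨c, hc, hcQ⟩ := exists_pos_mul_sq_le_quad hQ
  obtain ⟨r', hr', hball⟩ := Metric.nhds_basis_closedBall.mem_iff.1 (mem_interior_iff_mem_nhds.1 h0)
  obtain ⟨Vmax, hVmax⟩ := exists_cost_le hS b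
  -- A nominal state of norm at most `r` has optimal cost at most `‖P‖ r²`; being below `c r'²`,
  -- this confines all later nominal states to the ball of radius `r'`.
  obtain ⟨r, hr, hrr', hPr⟩ : ∃ r > 0, r ≤ r' ∧ ‖S.P‖ * r ^ 2 ≤ c * r' ^ 2 := by
    have hP := norm_nonneg S.P
    have hs : 0 < c / (‖S.P‖ + 1) := by positivity
    set s := min 1 (c / (‖S.P‖ + 1)) with hs_def
    have hs0 : 0 < s := lt_min one_pos hs
    have hs1 : s ≤ 1 := min_le_left _ _
    refine ⟨s * r', by positivity, by nlinarith, ?_⟩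
    have h2 : ‖S.P‖ * s ≤ c := by
      have : s * (‖S.P‖ + 1) ≤ c := by
        rw [← le_div_iff₀ (by positivity)]
        exact min_le_right _ _
      nlinarith
    calc ‖S.P‖ * (s * r') ^ 2 = (‖S.P‖ * s) * s * r' ^ 2 := by ring
      _ ≤ c * 1 * r' ^ 2 := by gcongr
      _ = c * r' ^ 2 := by ring
  -- Outside the ball of radius `r` each step costs at least `c r²`, so `m` such steps would make
  -- the optimal cost negative.
  obtain ⟨m, hm⟩ := exists_nat_gt (Vmax / (c * r ^ 2))
  have hcr : 0 < c * r ^ 2 := by positivity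
  rw [div_lt_iff₀ hcr] at hm
  refine ⟨m + 1, by omega, fun x₀ hx₀ hx₀b w hw => ?_⟩
  have hdom := hexpert.disturbedTraj_mem_rmpcDomain hS (feasibleDomain_subset_rmpcDomain hS hx₀) hw
  choose z u hopt hπ using fun t => hexpert _ (hdom t)
  set V : ℕ → ℝ := fun t => S.cost (z t) (u t) with hV
  have hVz : ∀ t, c * ‖z t‖ ^ 2 ≤ V t := fun t => (hcQ _).trans (quad_le_cost hS _ _)
  have hdec : ∀ t, V (t + 1) ≤ V t - c * ‖z t‖ ^ 2 := by
    intro t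
    -- The shifted inputs compete at the next state, whatever the disturbance.
    have hfeas := (hopt t).1.shift hS (hw t)
    rw [← hπ t] at hfeas
    have h1 : V (t + 1) ≤ _ := (hopt (t + 1)).2 _ _ hfeas
    have h2 := cost_shiftInputs hS (z t) (u t)
    have h3 := hcQ (z t)
    have h4 := quad_nonneg hS.R_pd.posSemidef (u t 0)
    simp only [hV] at h1 ⊢
    linarith
  have hanti : Antitone V := antitone_nat_of_succ_le fun t =>
    (hdec t).trans (sub_le_self _ (by positivity))
  have hV0 : V 0 ≤ Vmax := by
    obtain ⟨u', hu'⟩ := mem_feasibleDomain_iff.1 hx₀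
    refine ((hopt 0).2 x₀ u' ⟨hu', ?_⟩).trans (hVmax _ _ hx₀b hu')
    simpa [disturbedTraj] using mem_of_mem_nhds hS.E_inv.1
  obtain ⟨t, ht, hzt⟩ : ∃ t ≤ m, ‖z t‖ ≤ r := by
    by_contra! hcon
    have hlin : ∀ t ≤ m + 1, V t ≤ Vmax - t * (c * r ^ 2) := by
      intro t
      induction t with
      | zero => intro _; simpa using hV0
      | succ t ih =>
        intro ht
        have h1 := ih (by omega)
        have h2 := hdec t
        have h3 : c * r ^ 2 ≤ c * ‖z t‖ ^ 2 := by
          gcongr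
          exact (hcon t (by omega)).le
        push_cast
        linarith
    have h1 := hlin m (by omega)
    have h2 := hVz m
    have h3 : 0 ≤ c * ‖z m‖ ^ 2 := by positivity
    linarith
  have hzO : z t ∈ S.Obar := (hball (by simpa using hzt.trans hrr')).1
  -- The LQR inputs from `z t` compete with the optimal ones, since `z t` is in `Obar`.
  have hVt : V t ≤ c * r' ^ 2 := by
    have hfeas : S.RMPCFeasible (S.disturbedTraj expert w x₀ t) (z t)
        (fun k => S.lqr (S.lqrTraj (z t) k)) := by
      refine ⟨⟨fun k _ => ?_, ?_⟩, (hopt t).1.2⟩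
      · rw [nominal_lqr]
        exact mem_Obar_iff.1 hzO k
      · rw [nominal_lqr]
        exact lqrTraj_mem_Obar hzO _
    refine ((hopt t).2 _ _ hfeas).trans ?_
    rw [cost_lqr hS]
    refine (quad_le_norm_mul_sq _ _).trans (le_trans ?_ hPr)
    gcongr
  have hzτ : ‖z (m + 1)‖ ≤ r' := by
    have h1 : c * ‖z (m + 1)‖ ^ 2 ≤ c * r' ^ 2 :=
      (hVz _).trans ((hanti (by omega)).trans hVt)
    exact le_of_sq_le_sq (le_of_mul_le_mul_left h1 hc) hr'.le
  -- The true state is `z (m + 1)` plus an element of `E`, which the erosion absorbs.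
  have := (hball (by simpa using hzτ)).2 _ (hopt (m + 1)).1.2
  rwa [add_sub_cancel] at this

end RobustMPC

end MPCData

/-! ### The sample sizes have summable inverses. -/

section SampleSize

/-- Comparison with the telescoping differences of `1 / log`. Without summability the `tsum` in
`sampleConst` would default to `0`. -/
lemma summable_one_div_mul_log_sq :
    Summable fun k : ℕ => 1 / (((k : ℝ) + 1) * Real.log ((k : ℝ) + 2) ^ 2) := by
  have hlog : ∀ k : ℕ, 0 < Real.log ((k : ℝ) + 2) := fun k =>
    Real.log_pos (by linarith [(Nat.cast_nonneg k : (0 : ℝ) ≤ k)])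
  -- The first term is dropped because its telescoping bound would involve `1 / log 1`.
  rw [← summable_nat_add_iff 1]
  refine summable_of_sum_range_le (c := 2 * (1 / Real.log 2)) (fun k => by positivity) fun m => ?_
  have hterm : ∀ k : ℕ, 1 / ((((k + 1 : ℕ) : ℝ) + 1) * Real.log (((k + 1 : ℕ) : ℝ) + 2) ^ 2) ≤
      2 * (1 / Real.log ((k : ℝ) + 2) - 1 / Real.log (((k + 1 : ℕ) : ℝ) + 2)) := by
    intro k
    have hk : (0 : ℝ) ≤ k := Nat.cast_nonneg k
    have ha := hlog k
    have hb := hlog (k + 1)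
    push_cast at hb ⊢
    set a := Real.log ((k : ℝ) + 2)
    set b := Real.log ((k : ℝ) + 1 + 2) with hb_def
    have hdiff : 1 / ((k : ℝ) + 1 + 2) ≤ b - a := by
      have h1 := Real.one_sub_inv_le_log_of_pos
        (show 0 < ((k : ℝ) + 1 + 2) / ((k : ℝ) + 2) by positivity)
      rw [Real.log_div (by positivity) (by positivity)] at h1
      refine le_trans (le_of_eq ?_) h1
      field_simp
      ring
    have hab : a ≤ b := Real.log_le_log (by positivity) (by linarith)
    have h2 : 1 / a - 1 / b = (b - a) / (a * b) := by field_simp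
    have h3 : (1 / ((k : ℝ) + 1 + 2)) / b ^ 2 ≤ (b - a) / (a * b) :=
      div_le_div₀ (le_trans (by positivity) hdiff) hdiff (by positivity) (by nlinarith)
    rw [h2]
    refine le_trans ?_ (mul_le_mul_of_nonneg_left h3 (by norm_num))
    -- The factor `2` comes from `k + 3 ≤ 2 (k + 2)`.
    rw [div_div, mul_one_div, div_le_div_iff₀ (by positivity) (by positivity)]
    have : 0 < b ^ 2 := by positivity
    nlinarith
  refine (Finset.sum_le_sum fun k _ => hterm k).trans ?_
  rw [← Finset.mul_sum,
    Finset.sum_range_sub' fun k : ℕ => 1 / Real.log ((k : ℝ) + 2)]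
  have h1 := hlog m
  have h2 : 0 ≤ 1 / Real.log ((m : ℝ) + 2) := by positivity
  simp only [Nat.cast_zero, zero_add]
  linarith

lemma sampleConst_pos : 0 < sampleConst := by
  refine summable_one_div_mul_log_sq.tsum_pos (fun k => by positivity) 0 ?_
  have : 0 < Real.log 2 := Real.log_pos one_lt_two
  simp only [Nat.cast_zero, zero_add]
  positivity

lemma le_sampleSize (n t : ℕ) : n ≤ sampleSize n t := by
  have h : (n : ℝ) ≤ sampleSize n t := by
    refine le_trans ?_ (Nat.le_ceil _)
    have := sampleConst_pos
    exact le_add_of_nonneg_left (by positivity)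
  exact_mod_cast h

lemma one_div_sampleSize_succ_le {n : ℕ} (hn : 0 < n) (t : ℕ) :
    1 / (sampleSize n (t + 1) : ℝ) ≤
      1 / (sampleConst * n) * (1 / (((t : ℝ) + 1) * Real.log ((t : ℝ) + 2) ^ 2)) := by
  have hc := sampleConst_pos
  have hn' : (0 : ℝ) < n := Nat.cast_pos.2 hn
  have hlog : 0 < Real.log ((t : ℝ) + 2) :=
    Real.log_pos (by linarith [(Nat.cast_nonneg t : (0 : ℝ) ≤ t)])
  rw [one_div_mul_one_div]
  refine one_div_le_one_div_of_le (by positivity) (le_trans ?_ (Nat.le_ceil _))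
  have h1 : ((t + 1 : ℕ) : ℝ) + 1 = (t : ℝ) + 2 := by push_cast; ring
  have h2 := Nat.le_ceil (Real.log ((t : ℝ) + 2) ^ 2)
  rw [h1]
  push_cast
  calc sampleConst * n * (((t : ℝ) + 1) * Real.log ((t : ℝ) + 2) ^ 2)
      = sampleConst * n * ((t : ℝ) + 1) * Real.log ((t : ℝ) + 2) ^ 2 := by ring
    _ ≤ sampleConst * n * ((t : ℝ) + 1) * ⌈Real.log ((t : ℝ) + 2) ^ 2⌉₊ := by gcongr
    _ ≤ _ := le_add_of_nonneg_right hn'.le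

/-- Stage `0` contributes `1/n`; by the choice of `sampleConst` all later stages together contribute
at most another `1/n`. -/
lemma sum_one_div_sampleSize_le {n : ℕ} (hn : 0 < n) (m : ℕ) :
    ∑ t ∈ Finset.range m, 1 / (sampleSize n t : ℝ) ≤ 2 / n := by
  have hc := sampleConst_pos
  have hn' : (0 : ℝ) < n := Nat.cast_pos.2 hn
  have h0 : 1 / (sampleSize n 0 : ℝ) ≤ 1 / n :=
    one_div_le_one_div_of_le hn' (Nat.cast_le.2 (le_sampleSize n 0))
  have hsum : ∑ t ∈ Finset.range m, 1 / (sampleSize n (t + 1) : ℝ) ≤ 1 / n := by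
    refine (Finset.sum_le_sum fun t _ => one_div_sampleSize_succ_le hn t).trans ?_
    rw [← Finset.mul_sum]
    have := summable_one_div_mul_log_sq.sum_le_tsum (Finset.range m) fun k _ => by positivity
    calc _ ≤ 1 / (sampleConst * n) * sampleConst := by
            gcongr
            exact this
      _ = 1 / n := by field_simp
  calc ∑ t ∈ Finset.range m, 1 / (sampleSize n t : ℝ)
      ≤ ∑ t ∈ Finset.range (m + 1), 1 / (sampleSize n t : ℝ) :=
        Finset.sum_le_sum_of_subset_of_nonneg (Finset.range_mono m.le_succ)
          fun _ _ _ => by positivity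
    _ ≤ 1 / n + 1 / n := by
        rw [Finset.sum_range_succ']
        exact add_le_add hsum h0
    _ = 2 / n := by ring

end SampleSize

/-! ### Probability bounds for fresh samples. -/

section Probability

open scoped ENNReal

/-- If `X` is independent of a finite-valued variable `f`, an event about `X` chosen by means of `f`
has at most the largest of the probabilities of the possible events. -/
lemma measure_mem_of_indep_le {Ω α ι : Type*} [Finite ι] {m mΩ : MeasurableSpace Ω}
    [MeasurableSpace α] {μ : Measure Ω} [IsProbabilityMeasure μ] {X : Ω → α} {ν : Measure α}
    (hX : Measurable X) (hlaw : μ.map X = ν) (hm : m ≤ mΩ)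
    (hind : Indep (MeasurableSpace.comap X inferInstance) m μ) {f : Ω → ι}
    (hf : ∀ i, MeasurableSet[m] (f ⁻¹' {i})) {b : ι → Set α} (hb : ∀ i, MeasurableSet (b i))
    {β : ℝ≥0∞} (hβ : ∀ i, ν (b i) ≤ β) : μ {ω | X ω ∈ b (f ω)} ≤ β := by
  have := Fintype.ofFinite ι
  have hsub : {ω | X ω ∈ b (f ω)} ⊆ ⋃ i ∈ (Finset.univ : Finset ι), X ⁻¹' b i ∩ f ⁻¹' {i} := by
    intro ω hω
    simp only [Set.mem_iUnion]
    exact ⟨f ω, Finset.mem_univ _, hω, rfl⟩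
  -- No factor for the number of values of `f` is lost: the weights `μ (f = i)` sum to `1`.
  calc μ {ω | X ω ∈ b (f ω)} ≤ ∑ i, μ (X ⁻¹' b i ∩ f ⁻¹' {i}) :=
        (measure_mono hsub).trans (measure_biUnion_finset_le _ _)
    _ = ∑ i, ν (b i) * μ (f ⁻¹' {i}) := by
        refine Finset.sum_congr rfl fun i _ => ?_
        rw [(Indep_iff _ _ _).1 hind _ _ ⟨b i, hb i, rfl⟩ (hf i), ← hlaw,
          Measure.map_apply hX (hb i)]
    _ ≤ ∑ i, β * μ (f ⁻¹' {i}) := by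
        gcongr with i
        exact hβ i
    _ = β * μ (f ⁻¹' ((Finset.univ : Finset ι) : Set ι)) := by
        rw [← Finset.mul_sum, sum_measure_preimage_singleton _ fun i _ => hm _ (hf i)]
    _ ≤ β := by simp

variable {α : Type*} [MeasurableSpace α] {D : Measure α} [IsProbabilityMeasure D]

lemma pi_forall_mem_le {m : ℕ} {A : Set α} {η : ℝ} (hA : D.real A ≤ 1 - η) :
    (Measure.pi fun _ : Fin m => D) {x | ∀ i, x i ∈ A} ≤ ENNReal.ofReal (Real.exp (-(η * m))) := by
  have hset : {x : Fin m → α | ∀ i, x i ∈ A} = Set.univ.pi fun _ => A := by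
    ext x
    simp
  have hDA : D A ≤ ENNReal.ofReal (Real.exp (-η)) := by
    rw [← ofReal_measureReal]
    exact ENNReal.ofReal_le_ofReal (hA.trans (by linarith [Real.add_one_le_exp (-η)]))
  rw [hset, Measure.pi_pi, Finset.prod_const, Finset.card_univ, Fintype.card_fin]
  calc D A ^ m ≤ ENNReal.ofReal (Real.exp (-η)) ^ m := by gcongr
    _ = _ := by
      rw [← ENNReal.ofReal_pow (Real.exp_nonneg _), ← Real.exp_nat_mul]
      ring_nf

lemma pi_exists_mem_le {m : ℕ} {A : Set α} (hA : MeasurableSet A) {β : ℝ}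
    (hβ : D.real A ≤ β) :
    (Measure.pi fun _ : Fin m => D) {x | ∃ i, x i ∈ A} ≤ ENNReal.ofReal (m * β) := by
  have hset : {x : Fin m → α | ∃ i, x i ∈ A} = ⋃ i, Function.eval i ⁻¹' A := by
    ext x
    simp
  have hDA : D A ≤ ENNReal.ofReal β := by
    rw [← ofReal_measureReal]
    exact ENNReal.ofReal_le_ofReal hβ
  rw [hset]
  calc _ ≤ ∑ i : Fin m, (Measure.pi fun _ : Fin m => D) (Function.eval i ⁻¹' A) :=
        measure_iUnion_fintype_le _ _
    _ = ∑ _i : Fin m, D A := Finset.sum_congr rfl fun i _ =>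
        (measurePreserving_eval (fun _ : Fin m => D) i).measure_preimage hA.nullMeasurableSet
    _ ≤ m * ENNReal.ofReal β := by
        rw [Finset.sum_const, Finset.card_univ, Fintype.card_fin, nsmul_eq_mul]
        gcongr
    _ = _ := by rw [ENNReal.ofReal_mul (Nat.cast_nonneg m), ENNReal.ofReal_natCast]

lemma measurableSet_forall_mem {ι : Type*} [Countable ι] {A : Set α} (hA : MeasurableSet A) :
    MeasurableSet {x : ι → α | ∀ i, x i ∈ A} := by
  have : {x : ι → α | ∀ i, x i ∈ A} = ⋂ i, (fun x => x i) ⁻¹' A := by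
    ext x
    simp
  rw [this]
  exact MeasurableSet.iInter fun i => measurable_pi_apply i hA

lemma measurableSet_exists_mem {ι : Type*} [Countable ι] {A : Set α} (hA : MeasurableSet A) :
    MeasurableSet {x : ι → α | ∃ i, x i ∈ A} := by
  have : {x : ι → α | ∃ i, x i ∈ A} = ⋃ i, (fun x => x i) ⁻¹' A := by
    ext x
    simp
  rw [this]
  exact MeasurableSet.iUnion fun i => measurable_pi_apply i hA

/-- Subadditivity suffices, so `s` need not be measurable; it is applied to `closeEvent`. -/
lemma one_sub_measureReal_compl_le (s : Set α) : 1 - D.real sᶜ ≤ D.real s := by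
  have h := measureReal_union_le (μ := D) s sᶜ
  rw [Set.union_compl_self, probReal_univ] at h
  linarith

end Probability

/-! ### Learned trajectories, switching and safety. -/

namespace MPCData

variable {dx du : ℕ} {S : MPCData dx du} {expert : Policy dx du} {π : ℕ → Policy dx du}

section Trajectories

lemma traj_congr {π' : ℕ → Policy dx du} {t : ℕ} (h : ∀ s < t, π s = π' s) (x : Vec dx) :
    S.traj π x t = S.traj π' x t := by
  induction t with
  | zero => rfl
  | succ t ih =>
    rw [traj, traj, ih fun s hs => h s (hs.trans t.lt_succ_self), h t t.lt_succ_self]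

lemma measurable_traj {t : ℕ} (h : ∀ s < t, Measurable (π s)) :
    Measurable fun x => S.traj π x t := by
  induction t with
  | zero => exact measurable_id
  | succ t ih =>
    have ih' := ih fun s hs => h s (hs.trans t.lt_succ_self)
    exact continuous_step.measurable.comp (ih'.prodMk ((h t t.lt_succ_self).comp ih'))

lemma norm_input_le (hS : S.Standing) {u : Vec du} (hu : u ∈ S.U) : ‖u‖ ≤ S.inputBound := by
  obtain ⟨b, hb⟩ := hS.U_bdd.exists_norm_le
  refine le_csSup ⟨b, ?_⟩ ⟨u, hu, rfl⟩
  rintro _ ⟨v, hv, rfl⟩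
  exact hb v hv

/-- A trajectory whose inputs are close to the expert's is a disturbed trajectory of the expert. -/
lemma exists_disturbedTraj_eq (hε : 0 ≤ S.ε) {x₀ : Vec dx} {τ : ℕ}
    (h : ∀ t < τ, ‖S.B‖ * ‖expert (S.traj π x₀ t) - π t (S.traj π x₀ t)‖ ≤ S.ε) :
    ∃ w : ℕ → Vec dx, (∀ t, ‖w t‖ ≤ S.ε) ∧
      ∀ t ≤ τ, S.disturbedTraj expert w x₀ t = S.traj π x₀ t := by
  -- Setting `w` to zero from `τ` on keeps the bound at all times, as reaching times require.
  refine ⟨fun t => if t < τ then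
    WithLp.toLp 2 (S.B *ᵥ (π t (S.traj π x₀ t) - expert (S.traj π x₀ t)).ofLp) else 0, ?_, ?_⟩
  · intro t
    dsimp only
    split_ifs with ht
    · refine (S.B.l2_opNorm_mulVec _).trans ?_
      rw [norm_sub_rev]
      exact h t ht
    · simpa using hε
  · intro t ht
    induction t with
    | zero => rfl
    | succ t ih =>
      rw [disturbedTraj, ih (by omega), if_pos (by omega), ← step_eq_add, traj]

lemma traj_mem_rmpcDomain (hS : S.Standing) (hε : 0 ≤ S.ε) (hexpert : S.IsRobustMPC expert)
    {x₀ : Vec dx} (hx₀ : x₀ ∈ S.feasibleDomain) {τ : ℕ}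
    (h : ∀ t < τ, ‖S.B‖ * ‖expert (S.traj π x₀ t) - π t (S.traj π x₀ t)‖ ≤ S.ε) {t : ℕ}
    (ht : t ≤ τ) : S.traj π x₀ t ∈ S.rmpcDomain := by
  obtain ⟨w, hw, heq⟩ := exists_disturbedTraj_eq hε h
  rw [← heq t ht]
  exact hexpert.disturbedTraj_mem_rmpcDomain hS (feasibleDomain_subset_rmpcDomain hS hx₀) hw t

lemma ae_traj_mem_Obar (hε : 0 ≤ S.ε) {D : Measure (Vec dx)} {τ : ℕ}
    (hτ : τ ∈ S.reachTimes D expert) (π : ℕ → Policy dx du) :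
    ∀ᵐ x₀ ∂D, (∀ t < τ, ‖S.B‖ * ‖expert (S.traj π x₀ t) - π t (S.traj π x₀ t)‖ ≤ S.ε) →
      S.traj π x₀ τ ∈ S.Obar := by
  filter_upwards [hτ.2] with x₀ hx₀ h
  obtain ⟨w, hw, heq⟩ := exists_disturbedTraj_eq hε h
  rw [← heq τ le_rfl]
  exact hx₀ w hw

/-- If the inputs have little authority, all admissible inputs are close to the expert's. -/
lemma close_of_two_mul_inputBound_le (hS : S.Standing) (hε : 0 ≤ S.ε)
    (hexpert : S.IsRobustMPC expert) (hsmall : 2 * (‖S.B‖ * S.inputBound) ≤ S.ε)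
    (hexpert_input : ∀ x ∈ S.X, expert x ∈ S.U) (hπ : ∀ t, ∀ x ∈ S.X, π t x ∈ S.U)
    {x₀ : Vec dx} (hx₀ : x₀ ∈ S.feasibleDomain) (t : ℕ) :
    ‖S.B‖ * ‖expert (S.traj π x₀ t) - π t (S.traj π x₀ t)‖ ≤ S.ε := by
  induction t using Nat.strong_induction_on with
  | _ t ih =>
    -- Closeness before `t` keeps the state in `X`, where both inputs lie in `U`.
    have hX := (traj_mem_rmpcDomain hS hε hexpert hx₀ ih le_rfl).1
    refine le_trans ?_ hsmall
    have h1 := norm_input_le hS (hexpert_input _ hX)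
    have h2 := norm_input_le hS (hπ t _ hX)
    calc _ ≤ ‖S.B‖ * (S.inputBound + S.inputBound) := by
          gcongr
          exact (norm_sub_le _ _).trans (add_le_add h1 h2)
      _ = _ := by ring

end Trajectories

section SwitchTime

lemma tauStar_eq {D : Measure (Vec dx)} (h : (S.reachTimes D expert).Nonempty) :
    S.tauStar D expert = (sInf (S.reachTimes D expert) : ℕ) :=
  le_antisymm (iInf₂_le _ (Nat.sInf_mem h))
    (le_iInf₂ fun _ hτ => Nat.cast_le.2 (Nat.sInf_le hτ))

variable {T ℓ : ℕ} {v : ℕ → Fin ℓ → Vec dx}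

lemma switchTime_le : S.switchTime T ℓ π v ≤ T := Nat.sInf_le (Or.inr rfl)

lemma switchTime_le_succ {t : ℕ} (h : ∀ i, S.traj π (v t i) (t + 1) ∈ S.Obar) :
    S.switchTime T ℓ π v ≤ t + 1 := Nat.sInf_le (Or.inl ⟨t, rfl, h⟩)

lemma exists_of_switchTime_lt (h : S.switchTime T ℓ π v < T) :
    ∃ t, S.switchTime T ℓ π v = t + 1 ∧ ∀ i, S.traj π (v t i) (t + 1) ∈ S.Obar := by
  have hmem : S.switchTime T ℓ π v ∈
      ({τ | ∃ t, τ = t + 1 ∧ ∀ i, S.traj π (v t i) (t + 1) ∈ S.Obar} ∪ {T} : Set ℕ) :=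
    Nat.sInf_mem ⟨T, Or.inr rfl⟩
  exact hmem.resolve_right h.ne

/-- The switched trajectory follows the learned one up to the switch and the LQR one after it. -/
lemma traj_switched_eq {τ : ℕ} (x₀ : Vec dx) {t : ℕ} (ht : t ≤ τ) :
    S.traj (S.switched π τ) x₀ t = S.traj π x₀ t :=
  traj_congr (fun _ hs => if_pos (hs.trans_le ht)) x₀

lemma traj_switched_mem_Obar {τ : ℕ} {x₀ : Vec dx} (h : S.traj π x₀ τ ∈ S.Obar) (k : ℕ) :
    S.traj (S.switched π τ) x₀ (τ + k) ∈ S.Obar := by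
  induction k with
  | zero => rwa [add_zero, traj_switched_eq x₀ le_rfl]
  | succ k ih =>
    have hlqr : S.switched π τ (τ + k) = S.lqr := if_neg (by omega)
    rw [← add_assoc, traj, hlqr]
    exact lqrTraj_mem_Obar ih 1

lemma switched_safe (hS : S.Standing) (hε : 0 ≤ S.ε) (hexpert : S.IsRobustMPC expert)
    (hπ : ∀ t, ∀ x ∈ S.X, π t x ∈ S.U) {x₀ : Vec dx} (hx₀ : x₀ ∈ S.feasibleDomain) {τ : ℕ}
    (hreach : S.traj π x₀ τ ∈ S.Obar)
    (hclose : ∀ t < τ, ‖S.B‖ * ‖expert (S.traj π x₀ t) - π t (S.traj π x₀ t)‖ ≤ S.ε) (t : ℕ) :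
    S.traj (S.switched π τ) x₀ t ∈ S.X ∧
      S.switched π τ t (S.traj (S.switched π τ) x₀ t) ∈ S.U := by
  obtain ht | ht := lt_or_ge t τ
  · have hX := (traj_mem_rmpcDomain hS hε hexpert hx₀ hclose ht.le).1
    rw [traj_switched_eq x₀ ht.le, switched, if_pos ht]
    exact ⟨hX, hπ t _ hX⟩
  · obtain ⟨k, rfl⟩ := Nat.exists_eq_add_of_le ht
    have hO := traj_switched_mem_Obar hreach k
    refine ⟨(Obar_subset_Xbar hO).1, ?_⟩
    have hlqr : S.switched π τ (τ + k) = S.lqr := if_neg (by omega)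
    rw [hlqr]
    exact (lqr_mem_Ubar hO).1

end SwitchTime

end MPCData

/-! ### The bad events of a run. -/

namespace ForwardSwitch

variable {dx du : ℕ} {S : MPCData dx du} {D : Measure (Vec dx)} {Pol : Finset (Policy dx du)}
  {expert : Policy dx du} {n T ℓ : ℕ} {Ω : Type*} [mΩ : MeasurableSpace Ω] {μ : Measure Ω}
  (F : ForwardSwitch S D Pol expert n T ℓ μ)

lemma before_le (t : ℕ) : F.before t ≤ mΩ := (F.before_le_after t).trans (F.after_le t)

/-- The policies of the stages before `t`. -/
def policiesUpTo (t : ℕ) (ω : Ω) : Fin t → Pol := fun s => ⟨F.policy s ω, F.policy_mem s ω⟩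

/-- The controller that uses the policies `q` before time `t`. -/
def extendPolicies {t : ℕ} (q : Fin t → Pol) : ℕ → Policy dx du :=
  fun s => if h : s < t then q ⟨s, h⟩ else fun _ => 0

lemma traj_extendPolicies (t : ℕ) (ω : Ω) (x : Vec dx) :
    S.traj (extendPolicies (F.policiesUpTo t ω)) x t = S.traj (F.learned ω) x t :=
  MPCData.traj_congr (fun s hs => by simp [extendPolicies, hs, policiesUpTo, learned]) x

lemma measurable_traj_extendPolicies (hPol_meas : ∀ p ∈ Pol, Measurable p) {t : ℕ}
    (q : Fin t → Pol) : Measurable fun x => S.traj (extendPolicies q) x t :=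
  MPCData.measurable_traj fun s hs => by
    simp only [extendPolicies, hs, dif_pos]
    exact hPol_meas _ (q ⟨s, hs⟩).2

lemma after_mono : Monotone F.after :=
  monotone_nat_of_le_succ fun t => (F.after_le_before t).trans (F.before_le_after _)

lemma measurableSet_policiesUpTo_after {t k : ℕ} (htk : t ≤ k + 1) (q : Fin t → Pol) :
    MeasurableSet[F.after k] (F.policiesUpTo t ⁻¹' {q}) := by
  have : F.policiesUpTo t ⁻¹' {q} = ⋂ s : Fin t, {ω | F.policy s ω = q s} := by
    ext ω
    simp [policiesUpTo, funext_iff, Subtype.ext_iff]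
  rw [this]
  exact MeasurableSet.iInter fun s =>
    F.after_mono (show (s : ℕ) ≤ k by omega) _ (F.policy_meas s _ (q s).2)

lemma measurableSet_policiesUpTo_before (t : ℕ) (q : Fin t → Pol) :
    MeasurableSet[F.before t] (F.policiesUpTo t ⁻¹' {q}) := by
  cases t with
  | zero =>
    rw [show F.policiesUpTo 0 ⁻¹' {q} = Set.univ from
      Set.eq_univ_of_forall fun _ => Subsingleton.elim _ _]
    exact MeasurableSet.univ
  | succ t => exact F.after_le_before t _ (F.measurableSet_policiesUpTo_after le_rfl q)

/-- The earlier policies take finitely many values and are independent of the fresh sample, so they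
may be frozen. -/
lemma measure_train_mem_le [IsProbabilityMeasure μ] (t : ℕ)
    {b : (Fin t → Pol) → Set (Fin (sampleSize n t) → Vec dx)} (hb : ∀ q, MeasurableSet (b q))
    {β : ENNReal} (hβ : ∀ q, (Measure.pi fun _ => D) (b q) ≤ β) :
    μ {ω | F.train t ω ∈ b (F.policiesUpTo t ω)} ≤ β :=
  measure_mem_of_indep_le ((F.train_meas t).mono (F.after_le t) le_rfl) (F.train_law t)
    (F.before_le t) (F.train_indep t)
    (F.measurableSet_policiesUpTo_before t) hb hβ

lemma measure_test_mem_le [IsProbabilityMeasure μ] (t : ℕ)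
    {b : (Fin (t + 1) → Pol) → Set (Fin ℓ → Vec dx)} (hb : ∀ q, MeasurableSet (b q))
    {β : ENNReal} (hβ : ∀ q, (Measure.pi fun _ => D) (b q) ≤ β) :
    μ {ω | F.test t ω ∈ b (F.policiesUpTo (t + 1) ω)} ≤ β :=
  measure_mem_of_indep_le ((F.test_meas t).mono (F.before_le _) le_rfl) (F.test_law t)
    (F.after_le t) (F.test_indep t)
    (F.measurableSet_policiesUpTo_after le_rfl) hb hβ

/-- The initial states from which `p` and the expert disagree at time `t`. -/
def disagreement (S : MPCData dx du) (expert : Policy dx du) (π : ℕ → Policy dx du) (t : ℕ)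
    (p : Policy dx du) : Set (Vec dx) :=
  {x | p (S.traj π x t) ≠ expert (S.traj π x t)}

/-- Some policy agrees with the expert on the training sample of a stage although the probability
of a disagreement exceeds `η`. -/
lemma measure_misleading_train_le [IsProbabilityMeasure D] [IsProbabilityMeasure μ]
    (hPol_meas : ∀ p ∈ Pol, Measurable p) (hexpert : expert ∈ Pol) (t : ℕ) (η : ℝ) :
    μ {ω | ∃ p ∈ Pol, η < D.real (disagreement S expert (F.learned ω) t p) ∧
        ∀ i, F.train t ω i ∉ disagreement S expert (F.learned ω) t p} ≤
      ENNReal.ofReal (Pol.card * Real.exp (-(η * sampleSize n t))) := by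
  have hmeas : ∀ (q : Fin t → Pol), ∀ p ∈ Pol,
      MeasurableSet (disagreement S expert (extendPolicies q) t p) := fun q p hp =>
    (measurableSet_eq_fun
      ((hPol_meas p hp).comp (measurable_traj_extendPolicies hPol_meas q))
      ((hPol_meas _ hexpert).comp (measurable_traj_extendPolicies hPol_meas q))).compl
  have hmeas' : ∀ (q : Fin t → Pol), ∀ p ∈ Pol, MeasurableSet
      {x : Fin (sampleSize n t) → Vec dx | η < D.real (disagreement S expert (extendPolicies q) t p)
        ∧ ∀ i, x i ∈ (disagreement S expert (extendPolicies q) t p)ᶜ} := by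
    intro q p hp
    exact (MeasurableSet.const _).inter (measurableSet_forall_mem (hmeas q p hp).compl)
  refine le_trans (measure_mono fun ω hω => ?_)
    (F.measure_train_mem_le t (b := fun q => ⋃ p ∈ Pol,
      {x | η < D.real (disagreement S expert (extendPolicies q) t p) ∧
        ∀ i, x i ∈ (disagreement S expert (extendPolicies q) t p)ᶜ})
      (fun q => Finset.measurableSet_biUnion _ (hmeas' q)) fun q => ?_)
  · obtain ⟨p, hp, hη, hagree⟩ := hω
    refine Set.mem_biUnion hp ⟨?_, fun i => ?_⟩
    · simpa [disagreement, traj_extendPolicies] using hη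
    · simpa [disagreement, traj_extendPolicies] using hagree i
  -- Union bound over `Pol`; for each candidate, all samples miss a set of mass more than `η`.
  · refine (measure_biUnion_finset_le _ _).trans ((Finset.sum_le_card_nsmul Pol _
      (ENNReal.ofReal (Real.exp (-(η * sampleSize n t)))) fun p hp => ?_).trans ?_)
    · by_cases hη : η < D.real (disagreement S expert (extendPolicies q) t p)
      · simp only [hη, true_and]
        refine pi_forall_mem_le ?_
        rw [probReal_compl_eq_one_sub (hmeas q p hp)]
        linarith
      · simp [hη]
    · rw [nsmul_eq_mul, ENNReal.ofReal_mul (Nat.cast_nonneg _), ENNReal.ofReal_natCast]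

lemma measurableSet_traj_mem_Obar (hS : S.Standing) (hPol_meas : ∀ p ∈ Pol, Measurable p) {t : ℕ}
    (q : Fin t → Pol) : MeasurableSet {x | S.traj (extendPolicies q) x t ∈ S.Obar} :=
  measurable_traj_extendPolicies hPol_meas q (MPCData.isClosed_Obar hS).measurableSet

/-- The test of a stage is passed although the invariant set is not reached often enough. -/
lemma measure_misleading_pass_le [IsProbabilityMeasure D] [IsProbabilityMeasure μ]
    (hS : S.Standing) (hPol_meas : ∀ p ∈ Pol, Measurable p) (t : ℕ) (δ : ℝ) :
    μ {ω | D.real {x | S.traj (F.learned ω) x (t + 1) ∈ S.Obar} < 1 - δ ∧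
        ∀ i, S.traj (F.learned ω) (F.test t ω i) (t + 1) ∈ S.Obar} ≤
      ENNReal.ofReal (Real.exp (-(δ * ℓ))) := by
  have hmeas := fun q : Fin (t + 1) → Pol => measurableSet_traj_mem_Obar hS hPol_meas q
  refine le_trans (measure_mono fun ω hω => ?_)
    (F.measure_test_mem_le t (b := fun q =>
      {x | D.real {x | S.traj (extendPolicies q) x (t + 1) ∈ S.Obar} < 1 - δ ∧
        ∀ i, x i ∈ {x | S.traj (extendPolicies q) x (t + 1) ∈ S.Obar}})
      (fun q => ?_) fun q => ?_)
  · simpa [traj_extendPolicies] using hω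
  · exact (MeasurableSet.const _).inter (measurableSet_forall_mem (hmeas q))
  · by_cases hq : D.real {x | S.traj (extendPolicies q) x (t + 1) ∈ S.Obar} < 1 - δ
    · simp only [hq, true_and]
      exact pi_forall_mem_le hq.le
    · simp [hq]

/-- The test of a stage fails although the invariant set is missed with probability at most `β`. -/
lemma measure_misleading_fail_le [IsProbabilityMeasure D] [IsProbabilityMeasure μ]
    (hS : S.Standing) (hPol_meas : ∀ p ∈ Pol, Measurable p) (t : ℕ) (β : ℝ) :
    μ {ω | D.real {x | S.traj (F.learned ω) x (t + 1) ∉ S.Obar} ≤ β ∧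
        ∃ i, S.traj (F.learned ω) (F.test t ω i) (t + 1) ∉ S.Obar} ≤ ENNReal.ofReal (ℓ * β) := by
  have hmeas := fun q : Fin (t + 1) → Pol => (measurableSet_traj_mem_Obar hS hPol_meas q).compl
  refine le_trans (measure_mono fun ω hω => ?_)
    (F.measure_test_mem_le t (b := fun q =>
      {x | D.real {x | S.traj (extendPolicies q) x (t + 1) ∈ S.Obar}ᶜ ≤ β ∧
        ∃ i, x i ∈ {x | S.traj (extendPolicies q) x (t + 1) ∈ S.Obar}ᶜ})
      (fun q => ?_) fun q => ?_)
  · simpa [traj_extendPolicies, Set.compl_ofPred] using hω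
  · exact (MeasurableSet.const _).inter (measurableSet_exists_mem (hmeas q))
  · by_cases hq : D.real {x | S.traj (extendPolicies q) x (t + 1) ∈ S.Obar}ᶜ ≤ β
    · simp only [hq, true_and]
      exact pi_exists_mem_le (hmeas q) hq
    · simp [hq]

/-- Before the switch the learned policies agree with the expert on the training sample. -/
lemma train_notMem_disagreement (hexpert : expert ∈ Pol) {t : ℕ} {ω : Ω} (ht : t < F.tauHat ω)
    (i : Fin (sampleSize n t)) :
    F.train t ω i ∉ disagreement S expert (F.learned ω) t (F.policy t ω) := by
  have h := F.erm t ω ht expert hexpert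
  have hm : (0 : ℝ) < sampleSize n t := Nat.cast_pos.2 i.pos
  -- The expert's empirical loss is zero, hence so is the minimum, and every summand vanishes.
  simp only [MPCData.empLoss, sub_self, norm_zero, Finset.sum_const_zero, mul_zero] at h
  have hsum : ∑ i, ‖expert (S.traj (fun s => F.policy s ω) (F.train t ω i) t)
      - F.policy t ω (S.traj (fun s => F.policy s ω) (F.train t ω i) t)‖ ≤ 0 :=
    nonpos_of_mul_nonpos_right h (one_div_pos.2 hm)
  have hz := (Finset.sum_eq_zero_iff_of_nonneg fun _ _ => norm_nonneg _).1
    (le_antisymm hsum (Finset.sum_nonneg fun _ _ => norm_nonneg _)) i (Finset.mem_univ i)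
  rw [norm_eq_zero, sub_eq_zero] at hz
  exact fun hne => hne hz.symm

lemma measureReal_closeEvent_compl_le [IsProbabilityMeasure D] (hε : 0 ≤ S.ε)
    (hexpert : expert ∈ Pol) {ω : Ω} {η : ℕ → ℝ} (hη : ∀ t < T, ∀ p ∈ Pol,
      (∀ i, F.train t ω i ∉ disagreement S expert (F.learned ω) t p) →
        D.real (disagreement S expert (F.learned ω) t p) ≤ η t) :
    D.real (F.closeEvent ω)ᶜ ≤ ∑ t ∈ Finset.range (F.tauHat ω), η t := by
  have hsub : (F.closeEvent ω)ᶜ ⊆ ⋃ t ∈ Finset.range (F.tauHat ω),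
      disagreement S expert (F.learned ω) t (F.policy t ω) := by
    intro x hx
    simp only [closeEvent, Set.mem_compl_iff, Set.mem_ofPred_eq, not_forall] at hx
    obtain ⟨t, ht, hx⟩ := hx
    simp only [Set.mem_iUnion, Finset.mem_range]
    refine ⟨t, ht, fun heq => hx ?_⟩
    rw [learned, heq, sub_self, norm_zero, mul_zero]
    exact hε
  refine (measureReal_mono hsub (measure_ne_top _ _)).trans ((measureReal_biUnion_finset_le _ _).trans
    (Finset.sum_le_sum fun t ht => ?_))
  rw [Finset.mem_range] at ht
  exact hη t (ht.trans_le MPCData.switchTime_le) _ (F.policy_mem t ω)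
    (F.train_notMem_disagreement hexpert ht)

/-- Outside an event of small probability, the learned controller is close to the expert until the
switch, except for few initial states. -/
lemma exists_measureReal_closeEvent_compl_le [IsProbabilityMeasure D] [IsProbabilityMeasure μ]
    (hS : S.Standing) (hε : 0 < S.ε) {δ : ℝ} (hδ : δ ∈ Set.Ioo (0 : ℝ) 1)
    (hD_feas : ∀ᵐ x ∂D, x ∈ S.feasibleDomain) (hexpert : S.IsRobustMPC expert)
    (hPol_expert : expert ∈ Pol) (hPol_meas : ∀ p ∈ Pol, Measurable p)
    (hPol_input : ∀ p ∈ Pol, ∀ x ∈ S.X, p x ∈ S.U) (hT : 1 ≤ T) (hℓ : 1 ≤ ℓ)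
    (hn : 14 * ℓ * ‖S.B‖ * S.inputBound * Real.log (2 * T * ℓ * Pol.card / δ) / (S.ε * δ)
      ≤ (n : ℝ)) :
    ∃ N : Set Ω, μ N ≤ ENNReal.ofReal (δ / 2) ∧
      ∀ ω ∉ N, D.real (F.closeEvent ω)ᶜ ≤ 2 * δ / (7 * ℓ) := by
  have hδ0 := hδ.1
  have hℓ' : (1 : ℝ) ≤ ℓ := Nat.one_le_cast.2 hℓ
  have hT' : (1 : ℝ) ≤ T := Nat.one_le_cast.2 hT
  have hcard : (1 : ℝ) ≤ Pol.card := Nat.one_le_cast.2 (Finset.card_pos.2 ⟨_, hPol_expert⟩)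
  -- The bound on `n` carries the factor `‖B‖ B_u / ε`, which helps only if it exceeds `1/2`;
  -- otherwise closeness is automatic for feasible initial states.
  obtain hsmall | hlarge := le_or_gt (2 * (‖S.B‖ * S.inputBound)) S.ε
  · refine ⟨∅, by simp, fun ω _ => ?_⟩
    have hz : D.real (F.closeEvent ω)ᶜ = 0 := by
      rw [measureReal_eq_zero_iff]
      refine measure_mono_null (fun x hx => ?_) hD_feas
      refine fun hfeas => hx fun t _ => ?_
      exact MPCData.close_of_two_mul_inputBound_le hS hε.le hexpert hsmall
        (hPol_input _ hPol_expert) (fun t => hPol_input _ (F.policy_mem t ω)) hfeas t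
    rw [hz]
    positivity
  set a := 2 * T * ℓ * Pol.card / δ with ha
  have ha1 : 1 < a := by
    rw [ha, one_lt_div hδ0]
    have : (1 : ℝ) ≤ T * ℓ * Pol.card :=
      one_le_mul_of_one_le_of_one_le (one_le_mul_of_one_le_of_one_le hT' hℓ') hcard
    linarith [hδ.2]
  have hL : 0 < Real.log a := Real.log_pos ha1
  have hn7 : 7 * ℓ * Real.log a / δ ≤ n := by
    refine le_trans ?_ hn
    rw [div_le_div_iff₀ hδ0 (by positivity)]
    calc 7 * ℓ * Real.log a * (S.ε * δ) = 7 * ℓ * Real.log a * δ * S.ε := by ring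
      _ ≤ 7 * ℓ * Real.log a * δ * (2 * (‖S.B‖ * S.inputBound)) := by gcongr
      _ = _ := by ring
  have hn0 : (0 : ℝ) < n := lt_of_lt_of_le (by positivity) hn7
  have hn0' : 0 < n := Nat.cast_pos.1 hn0
  -- The threshold `log a / n_t` gives each stage failure probability `|Pol| / a = δ / (2Tℓ)`.
  refine ⟨⋃ t ∈ Finset.range T, {ω | ∃ p ∈ Pol,
    Real.log a / sampleSize n t < D.real (disagreement S expert (F.learned ω) t p) ∧
        ∀ i, F.train t ω i ∉ disagreement S expert (F.learned ω) t p}, ?_, fun ω hω => ?_⟩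
  · refine (measure_biUnion_finset_le _ _).trans ((Finset.sum_le_card_nsmul _ _
      (ENNReal.ofReal (δ / (2 * T * ℓ))) fun t _ => ?_).trans ?_)
    · refine (F.measure_misleading_train_le hPol_meas hPol_expert t _).trans
        (ENNReal.ofReal_le_ofReal (le_of_eq ?_))
      have hm : (0 : ℝ) < sampleSize n t := Nat.cast_pos.2 (hn0'.trans_le (le_sampleSize n t))
      rw [div_mul_cancel₀ _ hm.ne', Real.exp_neg, Real.exp_log (by linarith), ha]
      field_simp
    · rw [nsmul_eq_mul, ← ENNReal.ofReal_natCast, ← ENNReal.ofReal_mul (Nat.cast_nonneg _)]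
      refine ENNReal.ofReal_le_ofReal ?_
      rw [Finset.card_range]
      calc (T : ℝ) * (δ / (2 * T * ℓ)) = δ / 2 / ℓ := by field_simp
        _ ≤ δ / 2 := div_le_self (by positivity) hℓ'
  · simp only [Set.mem_iUnion, Finset.mem_range, Set.mem_ofPred_eq, not_exists, not_and] at hω
    refine (F.measureReal_closeEvent_compl_le hε.le hPol_expert
      (η := fun t => Real.log a / sampleSize n t) fun t ht p hp hagree => ?_).trans ?_
    · by_contra! hlt
      exact hω t ht p hp hlt hagree
    · calc ∑ t ∈ Finset.range (F.tauHat ω), Real.log a / (sampleSize n t : ℝ)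
          = Real.log a * ∑ t ∈ Finset.range (F.tauHat ω), 1 / (sampleSize n t : ℝ) := by
            rw [Finset.mul_sum]
            simp only [mul_one_div]
        _ ≤ Real.log a * (2 / n) := by
            gcongr
            exact sum_one_div_sampleSize_le hn0' _
        _ ≤ 2 * δ / (7 * ℓ) := by
            rw [div_le_iff₀ hδ0] at hn7
            rw [mul_div_assoc', div_le_div_iff₀ hn0 (by positivity)]
            linarith

/-- The closeness of the learned controller to the expert transfers the expert's reaching time. -/
lemma ae_mem_Obar_of_mem_closeEvent (hε : 0 ≤ S.ε) {ω : Ω} {τ : ℕ}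
    (hτ : τ ∈ S.reachTimes D expert) (hle : τ ≤ F.tauHat ω) :
    ∀ᵐ x ∂D, x ∈ F.closeEvent ω → S.traj (F.learned ω) x τ ∈ S.Obar := by
  filter_upwards [MPCData.ae_traj_mem_Obar hε hτ (F.learned ω)] with x hx hclose
  exact hx fun t ht => hclose t (ht.trans_le hle)

end ForwardSwitch

/-! ### The main theorem. -/

lemma MPCData.tauStar_ne_top {dx du : ℕ} {S : MPCData dx du} (hS : S.Standing)
    {D : Measure (Vec dx)} (hD_feas : ∀ᵐ x ∂D, x ∈ S.feasibleDomain)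
    (hD_bdd : ∃ r : ℝ, ∀ᵐ x ∂D, ‖x‖ ≤ r) {expert : Policy dx du} (hexpert : S.IsRobustMPC expert)
    (hQ : S.Q.PosDef) (h0 : (0 : Vec dx) ∈ interior (erode S.Obar S.E)) :
    S.tauStar D expert ≠ ⊤ := by
  obtain ⟨r, hr⟩ := hD_bdd
  obtain ⟨τ, hτ1, hτ⟩ := hexpert.exists_forall_disturbedTraj_mem_Obar hS hQ h0 r
  have hmem : τ ∈ S.reachTimes D expert := by
    refine ⟨hτ1, ?_⟩
    filter_upwards [hD_feas, hr] with x hx hxr using hτ x hx hxr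
  rw [tauStar_eq ⟨τ, hmem⟩]
  exact ENat.natCast_ne_top _

theorem theorem2 {dx du : ℕ} (S : MPCData dx du) (hS : S.Standing)
    (hε : S.ε ∈ Set.Ioo (0 : ℝ) 1) (δ : ℝ) (hδ : δ ∈ Set.Ioo (0 : ℝ) 1)
    (D : Measure (Vec dx)) [IsProbabilityMeasure D]
    (hD_feas : ∀ᵐ x ∂D, x ∈ S.feasibleDomain)
    (hD_bdd : ∃ r : ℝ, ∀ᵐ x ∂D, ‖x‖ ≤ r)
    (expert : Policy dx du) (hexpert : S.IsRobustMPC expert)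
    (Pol : Finset (Policy dx du)) (hPol_expert : expert ∈ Pol)
    (hPol_meas : ∀ p ∈ Pol, Measurable p)
    (hPol_input : ∀ p ∈ Pol, ∀ x ∈ S.X, p x ∈ S.U)
    (n T ℓ : ℕ) (hT : 1 ≤ T)
    (hn : 14 * ℓ * ‖S.B‖ * S.inputBound * Real.log (2 * T * ℓ * Pol.card / δ) / (S.ε * δ)
      ≤ (n : ℝ))
    (hl : 10 * Real.log (T / δ) / δ ≤ (ℓ : ℝ))
    {Ω : Type*} [MeasurableSpace Ω] (μ : Measure Ω) [IsProbabilityMeasure μ]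
    (F : ForwardSwitch S D Pol expert n T ℓ μ) :
    (S.Q.PosDef → (0 : Vec dx) ∈ interior (erode S.Obar S.E) → S.tauStar D expert ≠ ⊤) ∧
    ∃ G : Set Ω, MeasurableSet G ∧ 1 - 3 * δ ≤ μ.real G ∧ ∀ ω ∈ G,
      (F.tauHat ω : ℕ∞) ≤ S.tauStar D expert ∧
      (S.tauStar D expert ≤ (T : ℕ∞) ∨ F.tauHat ω < T →
        1 - δ ≤ D.real (F.reachEvent ω)) ∧
      1 - δ ≤ D.real (F.closeEvent ω) ∧
      ∀ x₀ ∈ S.feasibleDomain, x₀ ∈ F.reachEvent ω → x₀ ∈ F.closeEvent ω →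
        ∀ t, S.traj (F.output ω) x₀ t ∈ S.X ∧
          F.output ω t (S.traj (F.output ω) x₀ t) ∈ S.U := by
  refine ⟨MPCData.tauStar_ne_top hS hD_feas hD_bdd hexpert, ?_⟩
  have hδ0 := hδ.1
  have hε0 := hε.1.le
  have hT' : (1 : ℝ) ≤ T := Nat.one_le_cast.2 hT
  have hlog : 0 < Real.log (T / δ) := Real.log_pos ((one_lt_div hδ0).2 (hδ.2.trans_le hT'))
  have hℓ0 : (0 : ℝ) < ℓ := lt_of_lt_of_le (by positivity) hl
  have hℓ : 1 ≤ ℓ := Nat.cast_pos.1 hℓ0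
  have hℓ' : (1 : ℝ) ≤ ℓ := Nat.one_le_cast.2 hℓ
  obtain ⟨N₁, hN₁, hclose⟩ := F.exists_measureReal_closeEvent_compl_le hS hε.1 hδ hD_feas hexpert
    hPol_expert hPol_meas hPol_input hT hℓ hn
  set N₂ : Set Ω := ⋃ t ∈ Finset.range T,
    {ω | D.real {x | S.traj (F.learned ω) x (t + 1) ∈ S.Obar} < 1 - δ ∧
      ∀ i, S.traj (F.learned ω) (F.test t ω i) (t + 1) ∈ S.Obar}
  have hN₂ : μ N₂ ≤ ENNReal.ofReal δ := by
    refine (measure_biUnion_finset_le _ _).trans ((Finset.sum_le_card_nsmul _ _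
      (ENNReal.ofReal (δ / T)) fun t _ => ?_).trans ?_)
    · refine (F.measure_misleading_pass_le hS hPol_meas t δ).trans (ENNReal.ofReal_le_ofReal ?_)
      -- Only `ln (T/δ) ≤ δℓ` is needed, which makes each stage fail with probability at most `δ/T`.
      rw [div_le_iff₀ hδ0] at hl
      calc Real.exp (-(δ * ℓ)) ≤ Real.exp (-Real.log (T / δ)) :=
            Real.exp_le_exp.2 (by linarith)
        _ = δ / T := by rw [Real.exp_neg, Real.exp_log (by positivity), inv_div]
    · rw [nsmul_eq_mul, ← ENNReal.ofReal_natCast, ← ENNReal.ofReal_mul (Nat.cast_nonneg _),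
        Finset.card_range, mul_div_cancel₀ _ (by positivity)]
  -- This is `0` if there are no reaching times; the bound on `N₃` holds for any stage, so that case
  -- is harmless.
  set τ := sInf (S.reachTimes D expert) with hτ_def
  set N₃ : Set Ω := {ω | D.real {x | S.traj (F.learned ω) x (τ - 1 + 1) ∉ S.Obar} ≤
      2 * δ / (7 * ℓ) ∧ ∃ i, S.traj (F.learned ω) (F.test (τ - 1) ω i) (τ - 1 + 1) ∉ S.Obar}
  have hN₃ : μ N₃ ≤ ENNReal.ofReal δ := by
    refine (F.measure_misleading_fail_le hS hPol_meas _ _).trans (ENNReal.ofReal_le_ofReal ?_)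
    have : ℓ * (2 * δ / (7 * ℓ)) = 2 * δ / 7 := by field_simp
    linarith
  have hN : μ (N₁ ∪ N₂ ∪ N₃) ≤ ENNReal.ofReal (3 * δ) :=
    calc μ (N₁ ∪ N₂ ∪ N₃) ≤ μ N₁ + μ N₂ + μ N₃ :=
          (measure_union_le _ _).trans (by gcongr; exact measure_union_le _ _)
      _ ≤ ENNReal.ofReal (δ / 2) + ENNReal.ofReal δ + ENNReal.ofReal δ := by gcongr
      _ = ENNReal.ofReal (δ / 2 + δ + δ) := by
          rw [ENNReal.ofReal_add (by positivity) (by positivity),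
            ENNReal.ofReal_add (by positivity) (by positivity)]
      _ ≤ ENNReal.ofReal (3 * δ) := ENNReal.ofReal_le_ofReal (by linarith)
  -- Passing to a measurable hull avoids proving the bad events measurable.
  refine ⟨(toMeasurable μ (N₁ ∪ N₂ ∪ N₃))ᶜ, (measurableSet_toMeasurable _ _).compl, ?_, ?_⟩
  · rw [probReal_compl_eq_one_sub (measurableSet_toMeasurable _ _), Measure.real,
      measure_toMeasurable]
    have := ENNReal.toReal_le_of_le_ofReal (by positivity) hN
    linarith
  intro ω hω
  have hω' : ω ∉ N₁ ∪ N₂ ∪ N₃ := fun h => hω (subset_toMeasurable _ _ h)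
  simp only [Set.mem_union, not_or] at hω'
  obtain ⟨⟨hω₁, hω₂⟩, hω₃⟩ := hω'
  have hC := hclose ω hω₁
  have hCδ : 2 * δ / (7 * ℓ) ≤ δ := by
    rw [div_le_iff₀ (by positivity)]
    nlinarith
  have hiii : 1 - δ ≤ D.real (F.closeEvent ω) := by
    linarith [one_sub_measureReal_compl_le (D := D) (F.closeEvent ω)]
  have hi : (F.tauHat ω : ℕ∞) ≤ S.tauStar D expert := by
    by_cases hne : (S.reachTimes D expert).Nonempty
    · have hτmem : τ ∈ S.reachTimes D expert := Nat.sInf_mem hne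
      have hτ1 : τ - 1 + 1 = τ := Nat.sub_add_cancel hτmem.1
      rw [MPCData.tauStar_eq hne, Nat.cast_le]
      -- If the run went past `τ`, closeness up to `τ` would make misses at time `τ` rare; outside
      -- `N₃` the test of stage `τ - 1` would then pass and force the switch by time `τ`.
      by_contra! hlt
      rw [← hτ_def] at hlt
      have hmiss : D.real {x | S.traj (F.learned ω) x (τ - 1 + 1) ∉ S.Obar} ≤ 2 * δ / (7 * ℓ) := by
        refine le_trans (ENNReal.toReal_mono (measure_ne_top _ _) (measure_mono_ae ?_)) hC
        filter_upwards [F.ae_mem_Obar_of_mem_closeEvent hε0 hτmem hlt.le] with x hx hxO hxC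
        have hxO' : S.traj (F.learned ω) x (τ - 1 + 1) ∉ S.Obar := hxO
        rw [hτ1] at hxO'
        exact hxO' (hx hxC)
      have hpass : ∀ i, S.traj (F.learned ω) (F.test (τ - 1) ω i) (τ - 1 + 1) ∈ S.Obar := by
        by_contra! hfail
        exact hω₃ ⟨hmiss, hfail⟩
      have : F.tauHat ω ≤ τ - 1 + 1 := MPCData.switchTime_le_succ hpass
      omega
    · have htop : S.tauStar D expert = ⊤ := by
        rw [Set.not_nonempty_iff_eq_empty] at hne
        simp [MPCData.tauStar, hne]
      rw [htop]
      exact le_top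
  refine ⟨hi, fun hor => ?_, hiii, fun x₀ hx₀ hreach hcl =>
    MPCData.switched_safe hS hε0 hexpert (fun t => hPol_input _ (F.policy_mem t ω)) hx₀ hreach hcl⟩
  obtain hlt | hge := lt_or_ge (F.tauHat ω) T
  · obtain ⟨t, ht, hpass⟩ := MPCData.exists_of_switchTime_lt hlt
    by_contra! hcon
    refine hω₂ (Set.mem_biUnion (x := t) ?_ ⟨?_, hpass⟩)
    · have : F.tauHat ω = t + 1 := ht
      simp only [Finset.coe_range, Set.mem_Iio]
      omega
    · have : F.tauHat ω = t + 1 := ht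
      rwa [ForwardSwitch.reachEvent, this] at hcon
  -- Without an early switch, (i) and `tauStar ≤ T` force `τ = tauHat`, so closeness itself yields
  -- arrival and no test is needed.
  · have hTle := hor.resolve_right hge.not_gt
    have hne : (S.reachTimes D expert).Nonempty := by
      by_contra hne
      rw [Set.not_nonempty_iff_eq_empty] at hne
      simp [MPCData.tauStar, hne] at hTle
    rw [MPCData.tauStar_eq hne, Nat.cast_le] at hTle hi
    have hτ : τ = F.tauHat ω := le_antisymm (hTle.trans hge) hi
    refine hiii.trans (ENNReal.toReal_mono (measure_ne_top _ _) (measure_mono_ae ?_))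
    filter_upwards [F.ae_mem_Obar_of_mem_closeEvent hε0 (Nat.sInf_mem hne) hτ.le] with x hx hxC
    have := hx hxC
    rwa [← hτ_def, hτ] at this
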